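/- **Theorem.** The problems $1R1D$ and $mR1D$, defined as follows, are solvable in polynomial time. An instance consists of finite sets $D$ of demands, $R$ of resource types and, for each $r\in R$, $S^r$ of starting locations of type $r$; the number $l^r_s\in\mathbb Z_{\ge 0}$ of resources of type $r$ at $s\in S^r$; for each $d\in D$, a set $M_d\subseteq R$ of required resource types, a service start time $\tau_d\in\mathbb Z$, a service duration $\Delta_d\in\mathbb Z$ and a reward $w_d\in\mathbb Z$; and integer travel times $f_{sd}$, $f_{ij}$ from the starting locations $s$ and the locations of demands $i$ to the locations of the demands $d,j\in D$. Put $A_{ij}=1$ if $\tau_i+\Delta_i+f_{ij}\le\tau_j$ and $M_i\cap M_j\ne\emptyset$, and $A_{ij}=0$ otherwise; for $s\in S^r$ and $r\in M_d$ put $B_{sd}=1$ if $f_{sd}\le\tau_d$, and $B_{sd}=0$ otherwise. The task is to find an optimal solution $(x,y)$ of the integer program $$\max\ \sum_{d\in D} w_d\,y_d\quad\text{subject to}$$ $$\sum_{d:\,B_{sd}=1} x^r_{sd}\le l^r_s\qquad(r\in R,\ s\in S^r),$$ $$\sum_{s:\,B_{si}=1} x^r_{si}+\sum_{h:\,A_{hi}=1}x^r_{hi}=\sum_{j:\,A_{ij}=1}x^r_{ij}+x^r_{it}\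 \ge\ y_i\qquad(i\in D,\ r\in M_i),$$ where all variables take values in $\{0,1\}$. The variables are $y_d$ ($d\in D$; demand $d$ is satisfied), $x^r_{sd}$ ($s\in S^r$, $r\in M_d$, $B_{sd}=1$; type $r$ goes from $s$ to $d$ first), $x^r_{ij}$ ($r\in M_i\cap M_j$, $A_{ij}=1$; type $r$ serves $j$ directly after $i$) and $x^r_{dt}$ ($r\in M_d$; type $r$ serves $d$ last); the sums run over the variables that exist. $mR1D$ is the restriction to instances in which every demand requires exactly one resource type ($|M_d|=1$ for all $d\in D$), and $1R1D$ is the further restriction to $|R|=1$. For each of the two problems there is an algorithm that, on every such instance, outputs an optimal solution $(x,y)$ in a number of steps bounded by a polynomial in the size of the instance, that is, in the number of demands, resource types and starting locations plus the total binary length of the data. (Steps are counted on a random access machine with integer registers and memory, whose arithmetic operations are addition and subtraction, at one step per operation.) -/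

import Mathlib

open scoped BigOperators

namespace ResourceAllocation

/-! ### Machine model

A random access machine over the integers, programmed by structured programs. The state consists of
registers and of an integer-addressed memory, all holding integers. The arithmetic operations are
addition and subtraction only and every operation costs one step; there is no multiplication,
so an operation lengthens the binary representation of the numbers by at most one bit and
polynomial time on this machine is the same as polynomial time on Turing machines. -/

/-- Expressions: constants, registers, memory cells (indirect addressing), sums, differences. -/
inductive Expr
  | const (c : ℤ)
  | reg (x : ℕ)
  | mem (a : Expr)
  | add (a b : Expr)
  | sub (a b : Expr)

/-- Machine states: the contents of the registers and of the memory. -/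
structure State where
  reg : ℕ → ℤ
  mem : ℤ → ℤ

/-- The value of an expression in a state. -/
def Expr.val (σ : State) : Expr → ℤ
  | .const c => c
  | .reg x => σ.reg x
  | .mem a => σ.mem (a.val σ)
  | .add a b => a.val σ + b.val σ
  | .sub a b => a.val σ - b.val σ

/-- The number of steps needed to evaluate an expression: one for each node. -/
def Expr.cost : Expr → ℕ
  | .const _ => 1
  | .reg _ => 1
  | .mem a => a.cost + 1
  | .add a b => a.cost + b.cost + 1
  | .sub a b => a.cost + b.cost + 1

/-- Programs. The tests in `cond` and `loop` are `0 < e`. -/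
inductive Prog
  | skip
  | assign (x : ℕ) (e : Expr)
  | store (a e : Expr)
  | seq (p q : Prog)
  | cond (e : Expr) (p q : Prog)
  | loop (e : Expr) (p : Prog)

/-- `Exec p σ t σ'`: started in state `σ`, the program `p` halts after exactly `t` steps, in
state `σ'`. -/
inductive Exec : Prog → State → ℕ → State → Prop
  | skip (σ : State) : Exec .skip σ 1 σ
  | assign (σ : State) (x : ℕ) (e : Expr) :
      Exec (.assign x e) σ (e.cost + 1) { σ with reg := Function.update σ.reg x (e.val σ) }
  | store (σ : State) (a e : Expr) :
      Exec (.store a e) σ (a.cost + e.cost + 1)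
        { σ with mem := Function.update σ.mem (a.val σ) (e.val σ) }
  | seq {p q : Prog} {σ₁ σ₂ σ₃ : State} {t₁ t₂ : ℕ} (h₁ : Exec p σ₁ t₁ σ₂)
      (h₂ : Exec q σ₂ t₂ σ₃) : Exec (.seq p q) σ₁ (t₁ + t₂) σ₃
  | cond_pos {e : Expr} {p q : Prog} {σ σ' : State} {t : ℕ} (he : 0 < e.val σ)
      (h : Exec p σ t σ') : Exec (.cond e p q) σ (e.cost + 1 + t) σ'
  | cond_neg {e : Expr} {p q : Prog} {σ σ' : State} {t : ℕ} (he : ¬ 0 < e.val σ)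
      (h : Exec q σ t σ') : Exec (.cond e p q) σ (e.cost + 1 + t) σ'
  | loop_stop {e : Expr} {p : Prog} {σ : State} (he : ¬ 0 < e.val σ) :
      Exec (.loop e p) σ (e.cost + 1) σ
  | loop_step {e : Expr} {p : Prog} {σ₁ σ₂ σ₃ : State} {t₁ t₂ : ℕ} (he : 0 < e.val σ₁)
      (h₁ : Exec p σ₁ t₁ σ₂) (h₂ : Exec (.loop e p) σ₂ t₂ σ₃) :
      Exec (.loop e p) σ₁ (e.cost + 1 + t₁ + t₂) σ₃

/-- The initial state on input `L`: the input is in the cells `0, 1, …, L.length - 1`, and all other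
cells and all registers hold `0`. -/
def State.init (L : List ℤ) : State where
  reg := fun _ => 0
  mem := fun a => if 0 ≤ a then L.getD a.toNat 0 else 0

/-- The cells `0, 1, …, L.length - 1` hold the list `L`. -/
def State.Outputs (σ : State) (L : List ℤ) : Prop :=
  ∀ (i : ℕ) (h : i < L.length), σ.mem (i : ℤ) = L[i]

/-- The length of an integer in binary, with one bit for the sign. -/
def bitLength (z : ℤ) : ℕ := Nat.size z.natAbs + 1

/-- The vector `v 0, v 1, …, v (n-1)` as a list. -/
def listVec {n : ℕ} (v : Fin n → ℤ) : List ℤ := List.ofFn v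

/-- The matrix `A` as a list, row by row. -/
def listMat {m n : ℕ} (A : Fin m → Fin n → ℤ) : List ℤ :=
  (List.finRange m).flatMap fun i => listVec (A i)

/-! ### The allocation problem -/

/-- An instance of `mRmD`: the demands are `Fin nD`, the resource types `Fin nR`, and the starting
locations (of any type) `Fin nS`. -/
structure Instance where
  nD : ℕ
  nR : ℕ
  nS : ℕ
  /-- `S r` is the set of starting locations for resource type `r`. -/
  S : Fin nR → Finset (Fin nS)
  /-- `l r s` is the number of resources of type `r` starting at `s ∈ S r`. -/
  l : Fin nR → Fin nS → ℕ
  /-- `M d` is the set of resource types required by demand `d`. -/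
  M : Fin nD → Finset (Fin nR)
  /-- service start times -/
  τ : Fin nD → ℤ
  /-- service durations -/
  Δ : Fin nD → ℤ
  /-- rewards -/
  w : Fin nD → ℤ
  /-- travel times from a starting location to the location of a demand -/
  fS : Fin nS → Fin nD → ℤ
  /-- travel times from the location of a demand to that of another demand -/
  fD : Fin nD → Fin nD → ℤ

namespace Instance

variable (I : Instance)

/-- The instance as a list of integers (subsets are given by their characteristic vectors). -/
def encode : List ℤ :=
  [(I.nD : ℤ), (I.nR : ℤ), (I.nS : ℤ)]
    ++ listMat (fun r s => if s ∈ I.S r then 1 else 0)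
    ++ listMat (fun r s => if s ∈ I.S r then (I.l r s : ℤ) else 0)
    ++ listMat (fun d r => if r ∈ I.M d then 1 else 0)
    ++ listVec I.τ ++ listVec I.Δ ++ listVec I.w
    ++ listMat I.fS ++ listMat I.fD

/-- The size of an instance: the number of elements of the sets of demands, of resource types and of
starting locations, plus the total length in binary of the numbers that describe the instance. -/
def size : ℕ := I.nD + I.nR + I.nS + (I.encode.map bitLength).sum

/-- `A i j`: a resource can serve demand `j` immediately after demand `i`, and some resource type is
required by both. -/
def A (i j : Fin I.nD) : Prop :=
  I.τ i + I.Δ i + I.fD i j ≤ I.τ j ∧ (I.M i ∩ I.M j).Nonempty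

/-- `B r s d`: a resource of type `r ∈ M d` starting at `s ∈ S r` can serve demand `d` on time if it
serves `d` first. -/
def B (r : Fin I.nR) (s : Fin I.nS) (d : Fin I.nD) : Prop :=
  I.fS s d ≤ I.τ d ∧ s ∈ I.S r ∧ r ∈ I.M d

/-- `1R1D`: a single resource type, which each demand requires. -/
def Is1R1D : Prop := I.nR = 1 ∧ ∀ d, (I.M d).card = 1

/-- `mR1D`: any number of resource types, each demand requires a single type. -/
def IsmR1D : Prop := ∀ d, (I.M d).card = 1

/-- Values for the decision variables: `y d` tells whether demand `d` is satisfied, `xS r s d`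
whether resource type `r` from starting location `s` initially serves `d`, `xD r i j` whether
resource type `r` serves `j` after `i`, and `xT r d` whether resource type `r` serves `d` last. -/
structure Solution where
  y : Fin I.nD → ℤ
  xS : Fin I.nR → Fin I.nS → Fin I.nD → ℤ
  xD : Fin I.nR → Fin I.nD → Fin I.nD → ℤ
  xT : Fin I.nR → Fin I.nD → ℤ

variable {I}

/-- The objective: the total reward of the satisfied demands. -/
def Solution.reward (X : I.Solution) : ℤ := ∑ d, X.y d * I.w d

/-- The constraints of the integer program. A variable that the program does not have (because the
arc does not exist for the resource type in question) has the value `0`. -/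
structure Solution.Feasible (X : I.Solution) : Prop where
  /-- No more resources leave a starting location than are available there. -/
  supply : ∀ r, ∀ s ∈ I.S r, ∑ d, X.xS r s d ≤ (I.l r s : ℤ)
  /-- Conservation of flow at the demands. -/
  conservation : ∀ i, ∀ r ∈ I.M i,
    ∑ s, X.xS r s i + ∑ h, X.xD r h i = ∑ j, X.xD r i j + X.xT r i
  /-- A satisfied demand is served by all the resource types that it requires. -/
  service : ∀ i, ∀ r ∈ I.M i, X.y i ≤ ∑ s, X.xS r s i + ∑ h, X.xD r h i
  y_binary : ∀ d, X.y d = 0 ∨ X.y d = 1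
  xS_binary : ∀ r s d, X.xS r s d = 0 ∨ (X.xS r s d = 1 ∧ I.B r s d)
  xD_binary : ∀ r i j, X.xD r i j = 0 ∨ (X.xD r i j = 1 ∧ I.A i j ∧ r ∈ I.M i ∩ I.M j)
  xT_binary : ∀ r d, X.xT r d = 0 ∨ (X.xT r d = 1 ∧ r ∈ I.M d)

/-- Feasible solutions of maximum total reward. -/
def Solution.Optimal (X : I.Solution) : Prop :=
  X.Feasible ∧ ∀ X' : I.Solution, X'.Feasible → X'.reward ≤ X.reward

/-- A solution as a list of integers. -/
def Solution.encode (X : I.Solution) : List ℤ :=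
  listVec X.y
    ++ (List.finRange I.nR).flatMap (fun r => listMat (X.xS r))
    ++ (List.finRange I.nR).flatMap (fun r => listMat (X.xD r))
    ++ listMat X.xT

end Instance

/-- The instances with property `P` are solvable in polynomial time: there is one program that, on
each such instance, halts within a number of steps that is polynomial in the size of the instance
and outputs an optimal solution. -/
def SolvableInPolyTime (P : Instance → Prop) : Prop :=
  ∃ (prog : Prog) (bound : Polynomial ℕ), ∀ I : Instance, P I →
    ∃ (t : ℕ) (σ : State) (X : I.Solution),
      Exec prog (State.init I.encode) t σ ∧ t ≤ bound.eval I.size ∧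
        X.Optimal ∧ σ.Outputs X.encode

end ResourceAllocation

/-! The problem reduces to a circulation of maximum reward in a single network shared by all
resource types. A demand `d` becomes two parallel arcs from `inNode d` to `outNode d`: `y d`, of
capacity 1 and reward `w d`, and `pass d`, of large capacity and reward 0. The depot, node 0, feeds
one node for each pair of a type and a location and takes the resources back after their last
demands. All other arcs are the remaining variables, of reward 0, with capacity 1 if the variable
exists and 0 otherwise. Since a demand requires one type only, arcs of other types have capacity 0
at its two nodes. So conservation at these nodes is conservation for that type, and feasible
solutions and integral circulations turn into each other with the same reward
(`IsCirculation.feasible`, `isCirculation_ofSolution`). The case of one type is a special case.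

A circulation is optimal if complementary slackness holds with some potential (`Kilter.reward_le`).
With all arcs `y d` closed, zero flow and zero potential have this property, because every other
reward is 0. The arcs `y d` are then opened one at a time. If the reduced reward of the new arc is
at most 0, nothing has to change. Otherwise a tree of residual arcs of reduced reward 0 is grown
from its head, and the potential is raised on the tree by the smallest slack of a residual arc
leaving it, but at most by the reduced reward of the new arc (`State.Growing.next`). Either the tree
reaches the tail, and one unit is sent around the cycle (`augment_spec`), or the reduced reward of
the new arc drops to 0 and the arc may stay empty. A round that brings neither about adds a node to
the tree, so as many rounds as there are nodes suffice.

The algorithm is written in `Stmt`, a language with counting loops only and with a functional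
semantics `run`. Loop invariants prove it correct, and `exec_toProg` bounds the steps of the
compiled program by a polynomial in the numbers of rounds. These depend on the numbers of nodes and
arcs and on the length of the input list, never on the magnitude of rewards or times. -/

namespace ResourceAllocation

/-! ### Programs with counting loops -/

namespace State

/-- Writing a register. -/
def setReg (σ : State) (x : ℕ) (v : ℤ) : State := { σ with reg := Function.update σ.reg x v }

/-- Writing a memory cell. -/
def setMem (σ : State) (a v : ℤ) : State := { σ with mem := Function.update σ.mem a v }

/-- The memory, seen as sixteen interleaved arrays that are indexed by the integers. -/
def arr (σ : State) (j : Fin 16) (i : ℤ) : ℤ := σ.mem (16 * i + (j : ℕ))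

/-- Writing a cell of one of the arrays. -/
def setArr (σ : State) (j : Fin 16) (i v : ℤ) : State := σ.setMem (16 * i + (j : ℕ)) v

@[simp] theorem reg_setReg_self (σ : State) (x : ℕ) (v : ℤ) : (σ.setReg x v).reg x = v := by
  simp [setReg]

@[simp] theorem reg_setReg_of_ne (σ : State) {x y : ℕ} (h : y ≠ x) (v : ℤ) :
    (σ.setReg x v).reg y = σ.reg y := by simp [setReg, h]

@[simp] theorem mem_setReg (σ : State) (x : ℕ) (v : ℤ) : (σ.setReg x v).mem = σ.mem := rfl

@[simp] theorem arr_setReg (σ : State) (x : ℕ) (v : ℤ) : (σ.setReg x v).arr = σ.arr := rfl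

@[simp] theorem reg_setMem (σ : State) (a v : ℤ) : (σ.setMem a v).reg = σ.reg := rfl

@[simp] theorem reg_setArr (σ : State) (j : Fin 16) (i v : ℤ) : (σ.setArr j i v).reg = σ.reg := rfl

@[simp] theorem arr_setArr_self (σ : State) (j : Fin 16) (i v : ℤ) :
    (σ.setArr j i v).arr j = Function.update (σ.arr j) i v := by
  ext k
  by_cases h : k = i
  · subst h; simp [setArr, setMem, arr]
  · have : 16 * k + ((j : ℕ) : ℤ) ≠ 16 * i + ((j : ℕ) : ℤ) := by omega
    simp [setArr, setMem, arr, h]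

@[simp] theorem arr_setArr_of_ne (σ : State) {j j' : Fin 16} (h : j' ≠ j) (i v : ℤ) :
    (σ.setArr j i v).arr j' = σ.arr j' := by
  ext k
  have h1 := j.isLt
  have h2 := j'.isLt
  have h3 : (j' : ℕ) ≠ j := fun h' => h (Fin.ext h')
  have : 16 * k + ((j' : ℕ) : ℤ) ≠ 16 * i + ((j : ℕ) : ℤ) := by omega
  simp [setArr, setMem, arr, this]

end State

namespace Expr

/-- The double of an expression. -/
def dbl (e : Expr) : Expr := .add e e

/-- The cell with index `e` of the array `j`. -/
def arr (j : Fin 16) (e : Expr) : Expr := .mem (.add e.dbl.dbl.dbl.dbl (.const (j : ℕ)))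

@[simp] theorem val_const (σ : State) (c : ℤ) : (const c).val σ = c := rfl

@[simp] theorem val_reg (σ : State) (x : ℕ) : (reg x).val σ = σ.reg x := rfl

@[simp] theorem val_add (σ : State) (a b : Expr) : (add a b).val σ = a.val σ + b.val σ := rfl

@[simp] theorem val_sub (σ : State) (a b : Expr) : (sub a b).val σ = a.val σ - b.val σ := rfl

@[simp] theorem val_mem (σ : State) (a : Expr) : (mem a).val σ = σ.mem (a.val σ) := rfl

@[simp] theorem val_arr (σ : State) (j : Fin 16) (e : Expr) :
    (arr j e).val σ = σ.arr j (e.val σ) := by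
  simp only [arr, dbl, val, State.arr]
  congr 1
  ring

end Expr

/-- Statements: the loops `upto i n p` execute `p` for the values `0, 1, …, n - 1` of the
register `i`, where `n` is the content of a register. -/
inductive Stmt
  | skip
  | assign (x : ℕ) (e : Expr)
  | store (a e : Expr)
  | aset (j : Fin 16) (i e : Expr)
  | seq (p q : Stmt)
  | cond (e : Expr) (p q : Stmt)
  | upto (i n : ℕ) (p : Stmt)

/-- The state after the counting loop with body `f` and index register `i` has made `k` rounds. -/
def rounds (f : State → State) (i : ℕ) (σ : State) : ℕ → State
  | 0 => σ.setReg i 0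
  | k + 1 => (f (rounds f i σ k)).setReg i (k + 1)

namespace Stmt

/-- The state in which a statement halts. -/
def run : Stmt → State → State
  | skip, σ => σ
  | assign x e, σ => σ.setReg x (e.val σ)
  | store a e, σ => σ.setMem (a.val σ) (e.val σ)
  | aset j i e, σ => σ.setArr j (i.val σ) (e.val σ)
  | seq p q, σ => q.run (p.run σ)
  | cond e p q, σ => if 0 < e.val σ then p.run σ else q.run σ
  | upto i n p, σ => rounds p.run i σ (σ.reg n).toNat

/-- The program of a statement. -/
def toProg : Stmt → Prog
  | skip => .skip
  | assign x e => .assign x e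
  | store a e => .store a e
  | aset j i e => .store (.add i.dbl.dbl.dbl.dbl (.const (j : ℕ))) e
  | seq p q => .seq p.toProg q.toProg
  | cond e p q => .cond e p.toProg q.toProg
  | upto i n p => .seq (.assign i (.const 0)) (.loop (.sub (.reg n) (.reg i))
      (.seq p.toProg (.assign i (.add (.reg i) (.const 1)))))

/-- The registers that a statement may write. -/
def writes : Stmt → List ℕ
  | skip => []
  | assign x _ => [x]
  | store _ _ => []
  | aset _ _ _ => []
  | seq p q => p.writes ++ q.writes
  | cond _ p q => p.writes ++ q.writes
  | upto i _ p => i :: p.writes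

/-- The arrays that a statement may write. -/
def stores : Stmt → List (Fin 16)
  | skip => []
  | assign _ _ => []
  | store _ _ => List.finRange 16
  | aset j _ _ => [j]
  | seq p q => p.stores ++ q.stores
  | cond _ p q => p.stores ++ q.stores
  | upto _ _ p => p.stores

/-- The registers that hold the numbers of rounds of the loops. -/
def bounds : Stmt → List ℕ
  | skip => []
  | assign _ _ => []
  | store _ _ => []
  | aset _ _ _ => []
  | seq p q => p.bounds ++ q.bounds
  | cond _ p q => p.bounds ++ q.bounds
  | upto _ n p => n :: p.bounds

/-- No loop changes its index register. -/
def indexOk : Stmt → Bool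
  | skip => true
  | assign _ _ => true
  | store _ _ => true
  | aset _ _ _ => true
  | seq p q => p.indexOk && q.indexOk
  | cond _ p q => p.indexOk && q.indexOk
  | upto i _ p => !p.writes.contains i && p.indexOk

/-- The numbers of rounds are fixed during the execution, and no loop changes its index. -/
def ok (s : Stmt) : Bool := s.indexOk && s.bounds.all fun b => !s.writes.contains b

/-- A bound for the number of steps, as a polynomial in a bound for the number of rounds. -/
noncomputable def time : Stmt → Polynomial ℕ
  | skip => 1
  | assign _ e => Polynomial.C (e.cost + 1)
  | store a e => Polynomial.C (a.cost + e.cost + 1)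
  | aset j i e => Polynomial.C
      ((Expr.add i.dbl.dbl.dbl.dbl (.const (j : ℕ))).cost + e.cost + 1)
  | seq p q => p.time + q.time
  | cond e p q => Polynomial.C (e.cost + 1) + p.time + q.time
  | upto _ _ p => 6 + Polynomial.X * (p.time + 8)

/-! ### Frame properties, loop invariants and running time of statements -/

theorem reg_run_of_notMem {s : Stmt} {x : ℕ} (h : x ∉ s.writes) (σ : State) :
    (s.run σ).reg x = σ.reg x := by
  induction s generalizing σ with
  | skip => rfl
  | assign y e =>
    simp only [writes, List.mem_singleton] at h
    simp [run, h]
  | store a e => rfl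
  | aset j i e => rfl
  | seq p q hp hq =>
    simp only [writes, List.mem_append, not_or] at h
    simp [run, hp h.1, hq h.2]
  | cond e p q hp hq =>
    simp only [writes, List.mem_append, not_or] at h
    simp only [run]
    split_ifs
    · exact hp h.1 σ
    · exact hq h.2 σ
  | upto i n p hp =>
    simp only [writes, List.mem_cons, not_or] at h
    simp only [run]
    generalize (σ.reg n).toNat = k
    induction k with
    | zero => simp [rounds, h.1]
    | succ k ih => simp [rounds, h.1, hp h.2, ih]

theorem arr_run_of_notMem {s : Stmt} {j : Fin 16} (h : j ∉ s.stores) (σ : State) :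
    (s.run σ).arr j = σ.arr j := by
  induction s generalizing σ with
  | skip => rfl
  | assign y e => rfl
  | store a e => simp [stores] at h
  | aset j' i e =>
    simp only [stores, List.mem_singleton] at h
    simp [run, h]
  | seq p q hp hq =>
    simp only [stores, List.mem_append, not_or] at h
    simp [run, hp h.1, hq h.2]
  | cond e p q hp hq =>
    simp only [stores, List.mem_append, not_or] at h
    simp only [run]
    split_ifs
    · exact hp h.1 σ
    · exact hq h.2 σ
  | upto i n p hp =>
    simp only [stores] at h
    simp only [run]
    generalize (σ.reg n).toNat = k
    induction k with
    | zero => simp [rounds]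
    | succ k ih => simp [rounds, hp h, ih]

/-- Induction over the rounds of a counting loop. -/
theorem run_upto_induction {i n : ℕ} {p : Stmt} {σ : State} (Inv : ℤ → State → Prop) {c : ℤ}
    (hn : σ.reg n = c) (hc : 0 ≤ c) (h0 : Inv 0 (σ.setReg i 0))
    (hs : ∀ (k : ℤ) (τ : State), 0 ≤ k → k < c → τ.reg i = k → Inv k τ →
      Inv (k + 1) ((p.run τ).setReg i (k + 1))) :
    Inv c ((upto i n p).run σ) := by
  have key : ∀ k : ℕ, (k : ℤ) ≤ c → Inv k (rounds p.run i σ k) ∧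
      (rounds p.run i σ k).reg i = k := by
    intro k
    induction k with
    | zero => intro _; simpa [rounds] using h0
    | succ k ih =>
      intro hk
      push_cast at hk
      obtain ⟨h1, h2⟩ := ih (by omega)
      have := hs k _ (by omega) (by omega) h2 h1
      exact ⟨by simpa [rounds] using this, by simp [rounds]⟩
  obtain ⟨m, rfl⟩ := Int.eq_ofNat_of_zero_le hc
  have := (key m le_rfl).1
  simpa [run, hn] using this

/-- No register of `bounds` is ever written. Hence a bound `N` for their initial contents bounds the
rounds of every loop at every nesting depth, and `time` is evaluated at the same `N` throughout. -/
theorem exec_toProg {s : Stmt} (hok : s.indexOk = true) (hb : ∀ b ∈ s.bounds, b ∉ s.writes)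
    {N : ℕ} {σ : State} (hN : ∀ b ∈ s.bounds, (σ.reg b).toNat ≤ N) :
    ∃ t, Exec s.toProg σ t (s.run σ) ∧ t ≤ s.time.eval N := by
  induction s generalizing σ with
  | skip => exact ⟨1, .skip σ, by simp [time]⟩
  | assign x e => exact ⟨_, .assign σ x e, by simp [time]⟩
  | store a e => exact ⟨_, .store σ a e, by simp [time]⟩
  | aset j i e =>
    refine ⟨(Expr.add i.dbl.dbl.dbl.dbl (.const (j : ℕ))).cost + e.cost + 1, ?_, ?_⟩
    · have := Exec.store σ (.add i.dbl.dbl.dbl.dbl (.const (j : ℕ))) e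
      have h16 : (Expr.add i.dbl.dbl.dbl.dbl (.const (j : ℕ))).val σ = 16 * i.val σ + (j : ℕ) := by
        simp only [Expr.dbl, Expr.val]; ring
      rw [h16] at this
      exact this
    · simp [time]
  | seq p q hp hq =>
    simp only [indexOk, Bool.and_eq_true] at hok
    simp only [bounds, writes, List.mem_append, not_or] at hb hN
    obtain ⟨t₁, h₁, l₁⟩ := hp hok.1 (fun b h => (hb b (.inl h)).1) (fun b h => hN b (.inl h))
    obtain ⟨t₂, h₂, l₂⟩ := hq (σ := p.run σ) hok.2 (fun b h => (hb b (.inr h)).2) (fun b h => by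
      rw [reg_run_of_notMem (hb b (.inr h)).1]; exact hN b (.inr h))
    exact ⟨_, .seq h₁ h₂, by simp only [time, Polynomial.eval_add]; omega⟩
  | cond e p q hp hq =>
    simp only [indexOk, Bool.and_eq_true] at hok
    simp only [bounds, writes, List.mem_append, not_or] at hb hN
    by_cases he : 0 < e.val σ
    · obtain ⟨t, h, l⟩ := hp hok.1 (fun b h => (hb b (.inl h)).1) (fun b h => hN b (.inl h))
      refine ⟨e.cost + 1 + t, ?_, ?_⟩
      · simpa [run, toProg, he] using Exec.cond_pos (q := q.toProg) he h
      · simp only [time, Polynomial.eval_add, Polynomial.eval_C]; omega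
    · obtain ⟨t, h, l⟩ := hq hok.2 (fun b h => (hb b (.inr h)).2) (fun b h => hN b (.inr h))
      refine ⟨e.cost + 1 + t, ?_, ?_⟩
      · simpa [run, toProg, he] using Exec.cond_neg (p := p.toProg) he h
      · simp only [time, Polynomial.eval_add, Polynomial.eval_C]; omega
  | upto i n p hp =>
    simp only [indexOk, Bool.and_eq_true, Bool.not_eq_true', List.contains_eq_mem,
      decide_eq_false_iff_not] at hok
    simp only [bounds, writes, List.mem_cons, not_or] at hb hN
    have hin : i ≠ n := fun h => (hb n (.inl rfl)).1 h.symm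
    have hnp := (hb n (.inl rfl)).2
    set M := (σ.reg n).toNat with hM
    have hMN : M ≤ N := hN n (.inl rfl)
    have hreg : ∀ b, b ≠ i → b ∉ p.writes → ∀ k, (rounds p.run i σ k).reg b = σ.reg b := by
      intro b h1 h2 k
      induction k with
      | zero => simp [rounds, h1]
      | succ k ih => simp [rounds, h1, reg_run_of_notMem h2, ih]
    have hi : ∀ k : ℕ, (rounds p.run i σ k).reg i = k := by
      intro k; cases k <;> simp [rounds]
    -- The induction is over the number `j` of rounds still to come, because `Exec` unrolls a loop
    -- at its first round. A round costs 4 steps for the test and 4 for the increment besides the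
    -- body; the last, failing test costs 4.
    have loop : ∀ j ≤ M, ∃ t, Exec (.loop (.sub (.reg n) (.reg i))
        (.seq p.toProg (.assign i (.add (.reg i) (.const 1))))) (rounds p.run i σ (M - j)) t
          (rounds p.run i σ M) ∧ t ≤ j * (p.time.eval N + 8) + 4 := by
      intro j
      induction j with
      | zero =>
        intro _
        refine ⟨_, Exec.loop_stop ?_, ?_⟩
        · simp only [Expr.val, Nat.sub_zero, hi, hreg n hin.symm hnp]; omega
        · simp [Expr.cost]
      | succ j ih =>
        intro hj
        obtain ⟨t₂, h₂, l₂⟩ := ih (by omega)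
        obtain ⟨t₁, h₁, l₁⟩ := hp (σ := rounds p.run i σ (M - (j + 1))) hok.2
          (fun b h => (hb b (.inr h)).2) (fun b h => by
            rw [hreg b (hb b (.inr h)).1 (hb b (.inr h)).2]; exact hN b (.inr h))
        have h₃ := Exec.assign (p.run (rounds p.run i σ (M - (j + 1)))) i
          (.add (.reg i) (.const 1))
        have e1 : M - j = (M - (j + 1)) + 1 := by omega
        -- The body leaves the index alone, so incrementing it agrees with the direct assignment
        -- made by `rounds`.
        have e2 : ((p.run (rounds p.run i σ (M - (j + 1))))).reg i = (M - (j + 1) : ℕ) := by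
          rw [reg_run_of_notMem hok.1, hi]
        rw [e1] at h₂
        refine ⟨_, .loop_step ?_ (.seq (t₂ := (Expr.add (.reg i) (.const 1)).cost + 1) h₁ ?_) h₂, ?_⟩
        · simp only [Expr.val, hi, hreg n hin.symm hnp]; omega
        · convert h₃ using 1
          simp only [rounds, State.setReg, Expr.val, e2]
        · simp only [Expr.cost, Nat.add_mul]; omega
    obtain ⟨t, h, l⟩ := loop M le_rfl
    rw [Nat.sub_self] at h
    refine ⟨_, .seq (.assign σ i (.const 0)) h, ?_⟩
    simp only [time, Expr.cost, Polynomial.eval_add, Polynomial.eval_mul, Polynomial.eval_X]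
    have h8 : Polynomial.eval N (8 : Polynomial ℕ) = 8 := by simp
    have h6 : Polynomial.eval N (6 : Polynomial ℕ) = 6 := by simp
    rw [h8, h6]
    have := Nat.mul_le_mul_right (p.time.eval N + 8) hMN
    omega

/-- A sequence of statements. -/
def block : List Stmt → Stmt
  | [] => skip
  | [s] => s
  | s :: t :: l => seq s (block (t :: l))

/-- Execution under several conditions. -/
def whens : List Expr → Stmt → Stmt
  | [], p => p
  | e :: l, p => cond e (whens l p) skip

theorem run_whens (l : List Expr) (p : Stmt) (σ : State) :
    (whens l p).run σ = if ∀ e ∈ l, 0 < e.val σ then p.run σ else σ := by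
  induction l with
  | nil => simp [whens]
  | cons e l ih =>
    simp only [whens, run, ih, List.forall_mem_cons]
    by_cases he : 0 < e.val σ <;> simp [he]

end Stmt

/-! ### Circulations of maximum reward

`E` is a set of arcs, `V` a set of nodes; the arc `e` leads from `t e` to `h e`, has the capacity
`c e` and the reward `w e` per unit of flow. -/

section Circulation

variable {α β : Type*} [DecidableEq α] [DecidableEq β]

/-- Outflow minus inflow at the node `x`. -/
def divergence (E : Finset α) (t h : α → β) (f : α → ℤ) (x : β) : ℤ :=
  ∑ e ∈ E, f e * ((if t e = x then 1 else 0) - (if h e = x then 1 else 0))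

/-- The reduced reward of an arc with respect to a potential. -/
def reduced (t h : α → β) (w : α → ℤ) (p : β → ℤ) (e : α) : ℤ := w e + p (t e) - p (h e)

/-- The flow `f` respects the capacities, and complementary slackness holds with the potential `p`. -/
structure Kilter (E : Finset α) (t h : α → β) (w c f : α → ℤ) (p : β → ℤ) : Prop where
  nonneg : ∀ e ∈ E, 0 ≤ f e
  le_cap : ∀ e ∈ E, f e ≤ c e
  of_lt : ∀ e ∈ E, f e < c e → reduced t h w p e ≤ 0
  of_pos : ∀ e ∈ E, 0 < f e → 0 ≤ reduced t h w p e

-- Summation by parts. For a circulation the right-hand side vanishes, so rewards and reduced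
-- rewards give it the same total.
omit [DecidableEq α] in
theorem sum_potential_mul {E : Finset α} {V : Finset β} {t h : α → β}
    (ht : ∀ e ∈ E, t e ∈ V) (hh : ∀ e ∈ E, h e ∈ V) (p : β → ℤ) (f : α → ℤ) :
    ∑ e ∈ E, (p (t e) - p (h e)) * f e = ∑ x ∈ V, p x * divergence E t h f x := by
  simp only [divergence, Finset.mul_sum]
  rw [Finset.sum_comm]
  refine Finset.sum_congr rfl fun e he => ?_
  simp only [mul_sub, mul_ite, mul_one, mul_zero, Finset.sum_sub_distrib, Finset.sum_ite_eq,
    ht e he, hh e he, if_true]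
  ring

omit [DecidableEq α] in
/-- A circulation in kilter has the maximum reward. -/
theorem Kilter.reward_le {E : Finset α} {V : Finset β} {t h : α → β} {w c f : α → ℤ} {p : β → ℤ}
    (ht : ∀ e ∈ E, t e ∈ V) (hh : ∀ e ∈ E, h e ∈ V) (hk : Kilter E t h w c f p)
    (hf : ∀ x ∈ V, divergence E t h f x = 0) {g : α → ℤ} (hg : ∀ x ∈ V, divergence E t h g x = 0)
    (g0 : ∀ e ∈ E, 0 ≤ g e) (gc : ∀ e ∈ E, g e ≤ c e) :
    ∑ e ∈ E, w e * g e ≤ ∑ e ∈ E, w e * f e := by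
  have hpf : ∑ e ∈ E, (p (t e) - p (h e)) * f e = 0 := by
    rw [sum_potential_mul ht hh p f]
    exact Finset.sum_eq_zero fun x hx => by rw [hf x hx, mul_zero]
  have hpg : ∑ e ∈ E, (p (t e) - p (h e)) * g e = 0 := by
    rw [sum_potential_mul ht hh p g]
    exact Finset.sum_eq_zero fun x hx => by rw [hg x hx, mul_zero]
  -- The comparison holds arc by arc: a negative reduced reward forces `f e = 0`, a positive one
  -- forces `f e = c e`.
  have key : ∑ e ∈ E, reduced t h w p e * g e ≤ ∑ e ∈ E, reduced t h w p e * f e := by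
    refine Finset.sum_le_sum fun e he => ?_
    have := g0 e he
    have := gc e he
    rcases lt_trichotomy (reduced t h w p e) 0 with hr | hr | hr
    · have : f e = 0 := by
        have h1 := hk.nonneg e he
        have h2 := hk.of_pos e he
        omega
      nlinarith
    · simp [hr]
    · have : f e = c e := by
        have h1 := hk.le_cap e he
        have h2 := hk.of_lt e he
        omega
      nlinarith
  have split : ∀ u : α → ℤ, ∑ e ∈ E, reduced t h w p e * u e
      = ∑ e ∈ E, w e * u e + ∑ e ∈ E, (p (t e) - p (h e)) * u e := by
    intro u
    rw [← Finset.sum_add_distrib]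
    exact Finset.sum_congr rfl fun e _ => by rw [reduced]; ring
  rw [split, split, hpf, hpg] at key
  linarith

theorem divergence_update {E : Finset α} {t h : α → β} {e : α} (he : e ∈ E) (f : α → ℤ) (v : ℤ)
    (x : β) : divergence E t h (Function.update f e v) x = divergence E t h f x
      + (v - f e) * ((if t e = x then 1 else 0) - (if h e = x then 1 else 0)) := by
  simp only [divergence]
  rw [← Finset.add_sum_erase _ _ he, ← Finset.add_sum_erase _ _ he, Function.update_self]
  rw [Finset.sum_congr rfl fun e' he' => by
    rw [Function.update_of_ne (Finset.ne_of_mem_erase he')]]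
  ring

/-! ### Residual arcs, search trees and augmentation -/

/-- The residual network has the arc `e`, possibly reversed, from `x` to `z`. -/
def ResArc (t h : α → β) (c f : α → ℤ) (e : α) (x z : β) : Prop :=
  (t e = x ∧ h e = z ∧ f e < c e) ∨ (h e = x ∧ t e = z ∧ 0 < f e)

omit [DecidableEq α] [DecidableEq β] in
/-- Complementary slackness is preserved if the potential is raised, by at most the slack of the
residual arcs leaving the set, on the set of the nodes `x` with `0 < T x`. -/
theorem Kilter.raise {E : Finset α} {V : Finset β} {t h : α → β} {w c f : α → ℤ} {p p' T : β → ℤ}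
    (ht : ∀ e ∈ E, t e ∈ V) (hh : ∀ e ∈ E, h e ∈ V) (hk : Kilter E t h w c f p) {δ : ℤ}
    (hδ : 0 ≤ δ) (hp : ∀ x ∈ V, p' x = if 0 < T x then p x + δ else p x)
    (h1 : ∀ e ∈ E, 0 < T (t e) → ¬ 0 < T (h e) → f e < c e → δ ≤ -reduced t h w p e)
    (h2 : ∀ e ∈ E, 0 < T (h e) → ¬ 0 < T (t e) → 0 < f e → δ ≤ reduced t h w p e) :
    Kilter E t h w c f p' := by
  refine ⟨hk.nonneg, hk.le_cap, fun e he hlt => ?_, fun e he hpos => ?_⟩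
  · have a1 := hk.of_lt e he hlt
    have a2 := fun a b => h1 e he a b hlt
    simp only [reduced, hp _ (ht e he), hp _ (hh e he)] at a1 a2 ⊢
    -- The reduced reward grows by `δ` if only the tail is raised, falls by `δ` if only the head is,
    -- and is unchanged otherwise.
    by_cases hA : 0 < T (t e) <;> by_cases hB : 0 < T (h e) <;>
      simp only [hA, hB, if_true, if_false, not_true_eq_false, not_false_eq_true,
        forall_const] at a2 ⊢ <;> omega
  · have a1 := hk.of_pos e he hpos
    have a2 := fun a b => h2 e he a b hpos
    simp only [reduced, hp _ (ht e he), hp _ (hh e he)] at a1 a2 ⊢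
    by_cases hA : 0 < T (t e) <;> by_cases hB : 0 < T (h e) <;>
      simp only [hA, hB, if_true, if_false, not_true_eq_false, not_false_eq_true,
        forall_const] at a2 ⊢ <;> omega

/-- The arcs `par z` form, on the set of the nodes `x` with `0 < T x`, a tree with the root `v` that
consists of residual arcs with reduced reward `0`. The function `rank` increases along the tree. -/
structure Tree (E : Finset α) (V : Finset β) (t h : α → β) (w c f : α → ℤ) (p T : β → ℤ)
    (par : β → α) (v : β) (rank : β → ℕ) : Prop where
  root : 0 < T v
  step : ∀ z ∈ V, 0 < T z → z ≠ v → par z ∈ E ∧ reduced t h w p (par z) = 0 ∧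
    ∃ x ∈ V, 0 < T x ∧ rank x < rank z ∧ ResArc t h c f (par z) x z

-- Both ends of a tree arc are raised, so its reduced reward remains 0.
omit [DecidableEq α] [DecidableEq β] in
theorem Tree.raise {E : Finset α} {V : Finset β} {t h : α → β} {w c f : α → ℤ} {p p' T : β → ℤ}
    {par : β → α} {v : β} {rank : β → ℕ} (hT : Tree E V t h w c f p T par v rank) {δ : ℤ}
    (hp : ∀ x ∈ V, p' x = if 0 < T x then p x + δ else p x) :
    Tree E V t h w c f p' T par v rank := by
  refine ⟨hT.root, fun z hz h1 h2 => ?_⟩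
  obtain ⟨a, b, x, hx, c1, c2, c3⟩ := hT.step z hz h1 h2
  refine ⟨a, ?_, x, hx, c1, c2, c3⟩
  rcases c3 with ⟨d1, d2, -⟩ | ⟨d1, d2, -⟩ <;>
  · simp only [reduced, d1, d2, hp _ hx, hp _ hz, if_pos c1, if_pos h1] at *
    omega

-- The new node gets a rank above all ranks present. Ranks are thus bounded by the number of
-- attachments, which later bounds the length of the augmenting path.
omit [DecidableEq α] in
theorem Tree.grow {E : Finset α} {V : Finset β} {t h : α → β} {w c f : α → ℤ} {p T : β → ℤ}
    {par : β → α} {v : β} {rank : β → ℕ} (hT : Tree E V t h w c f p T par v rank) {k : ℕ}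
    (hr : ∀ x ∈ V, 0 < T x → rank x ≤ k) {e : α} {x z : β} (he : e ∈ E) (hx : x ∈ V)
    (hTx : 0 < T x) (hTz : ¬ 0 < T z) (ha : ResArc t h c f e x z)
    (h0 : reduced t h w p e = 0) :
    Tree E V t h w c f p (Function.update T z 1) (Function.update par z e) v
        (Function.update rank z (k + 1)) ∧
      ∀ y ∈ V, 0 < Function.update T z 1 y → Function.update rank z (k + 1) y ≤ k + 1 := by
  have hne : ∀ y, 0 < T y → y ≠ z := fun y hy h' => hTz (h' ▸ hy)
  refine ⟨⟨?_, fun y hy h1 h2 => ?_⟩, fun y hy h1 => ?_⟩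
  · rw [Function.update_of_ne (hne v hT.root)]; exact hT.root
  · by_cases hyz : y = z
    · subst hyz
      refine ⟨by simpa using he, by simpa using h0, x, hx, ?_, ?_, by simpa using ha⟩
      · rwa [Function.update_of_ne (hne x hTx)]
      · rw [Function.update_of_ne (hne x hTx), Function.update_self]
        have := hr x hx hTx
        omega
    · rw [Function.update_of_ne hyz] at h1
      obtain ⟨a, b, x', hx', c1, c2, c3⟩ := hT.step y hy h1 h2
      rw [Function.update_of_ne hyz, Function.update_of_ne hyz]
      refine ⟨a, b, x', hx', ?_, ?_, c3⟩
      · rwa [Function.update_of_ne (hne x' c1)]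
      · rwa [Function.update_of_ne (hne x' c1)]
  · by_cases hyz : y = z
    · subst hyz; simp
    · rw [Function.update_of_ne hyz] at h1 ⊢
      have := hr y hy h1
      omega

/-- The situation during an augmentation: the flow has been changed on the path from `cur` to the
end of the path, the path from the root `v` to `cur` is still to be treated. -/
structure Augmenting (E : Finset α) (V : Finset β) (t h : α → β) (w c f : α → ℤ) (p : β → ℤ)
    (par : β → α) (v cur : β) (T : β → ℤ) (rank : β → ℕ) : Prop where
  kilter : Kilter E t h w c f p
  mem : cur ∈ V
  pos : 0 < T cur
  div : ∀ x ∈ V, divergence E t h f x = (if cur = x then 1 else 0) - (if v = x then 1 else 0)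
  step : ∀ z ∈ V, 0 < T z → z ≠ v → rank z ≤ rank cur → par z ∈ E ∧
    reduced t h w p (par z) = 0 ∧ ∃ x ∈ V, 0 < T x ∧ rank x < rank z ∧ ResArc t h c f (par z) x z

-- Complementary slackness puts no condition on the flow of an arc of reduced reward 0, apart from
-- the capacity bounds.
omit [DecidableEq β] in
theorem Kilter.update {E : Finset α} {t h : α → β} {w c f : α → ℤ} {p : β → ℤ}
    (hk : Kilter E t h w c f p) {e : α} {a : ℤ} (h0 : reduced t h w p e = 0) (ha : 0 ≤ a)
    (hc : a ≤ c e) : Kilter E t h w c (Function.update f e a) p := by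
  refine ⟨fun e' he' => ?_, fun e' he' => ?_, fun e' he' => ?_, fun e' he' => ?_⟩ <;>
  by_cases h' : e' = e
  · subst h'; simpa
  · simpa [h'] using hk.nonneg e' he'
  · subst h'; simpa
  · simpa [h'] using hk.le_cap e' he'
  · subst h'; simp [h0]
  · simpa [h'] using hk.of_lt e' he'
  · subst h'; simp [h0]
  · simpa [h'] using hk.of_pos e' he'

/-- Changing the flow on `par cur` by one unit, in the direction away from the root, moves the
surplus from `cur` to its predecessor. The rank drops, so the walk ends. -/
theorem Augmenting.next {E : Finset α} {V : Finset β} {t h : α → β} {w c f : α → ℤ} {p : β → ℤ}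
    {par : β → α} {v cur : β} {T : β → ℤ} {rank : β → ℕ}
    (hA : Augmenting E V t h w c f p par v cur T rank) (hcur : cur ≠ v) {f' : α → ℤ} {cur' : β}
    (hf : f' = Function.update f (par cur)
      (if h (par cur) = cur then f (par cur) + 1 else f (par cur) - 1))
    (hc : cur' = if h (par cur) = cur then t (par cur) else h (par cur)) :
    Augmenting E V t h w c f' p par v cur' T rank ∧ rank cur' < rank cur := by
  obtain ⟨he, h0, x, hx, hTx, hrk, harc⟩ := hA.step cur hA.mem hA.pos hcur le_rfl
  have hxc : x ≠ cur := fun h' => by rw [h'] at hrk; omega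
  have hx' : cur' = x := by
    rw [hc]
    rcases harc with ⟨h1, h2, -⟩ | ⟨h1, h2, -⟩
    · rw [if_pos h2, h1]
    · rw [if_neg (by rw [h1]; exact hxc), h1]
  subst hx'
  -- The arcs still to be used are not the one just changed. If the two coincided with the same
  -- orientation, `z` would be `cur`; with opposite orientations, `cur` would be the predecessor of
  -- `z`. Both contradict the ranks.
  have hne : ∀ z ∈ V, 0 < T z → z ≠ v → rank z ≤ rank cur' → par z ≠ par cur := by
    intro z hz hTz hzv hr hpar
    obtain ⟨-, -, y, -, -, hry, hzarc⟩ := hA.step z hz hTz hzv (by omega)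
    rw [hpar] at hzarc
    have hzc : z ≠ cur := fun h' => by rw [h'] at hr; omega
    rcases harc with ⟨h1, h2, -⟩ | ⟨h1, h2, -⟩ <;>
      rcases hzarc with ⟨h3, h4, -⟩ | ⟨h3, h4, -⟩
    · exact hzc (h4.symm.trans h2)
    · have : y = cur := h3.symm.trans h2
      rw [this] at hry; omega
    · have : y = cur := h3.symm.trans h2
      rw [this] at hry; omega
    · exact hzc (h4.symm.trans h2)
  refine ⟨⟨?_, hx, hTx, fun y hy => ?_, fun z hz hTz hzv hr => ?_⟩, hrk⟩
  · rw [hf]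
    have n0 := hA.kilter.nonneg _ he
    have n1 := hA.kilter.le_cap _ he
    rcases harc with ⟨h1, h2, h3⟩ | ⟨h1, h2, h3⟩
    · rw [if_pos h2]; exact hA.kilter.update h0 (by omega) (by omega)
    · rw [if_neg (by rw [h1]; exact hxc)]; exact hA.kilter.update h0 (by omega) (by omega)
  · rw [hf, divergence_update he, hA.div y hy]
    rcases harc with ⟨h1, h2, h3⟩ | ⟨h1, h2, h3⟩
    · rw [if_pos h2, h1, h2]; ring
    · rw [if_neg (c := h (par cur) = cur) (by rw [h1]; exact hxc), h1, h2]; ring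
  · obtain ⟨a, b, y, hy, c1, c2, c3⟩ := hA.step z hz hTz hzv (by omega)
    refine ⟨a, b, y, hy, c1, c2, ?_⟩
    rw [hf]
    simpa [ResArc, hne z hz hTz hzv hr] using c3

/-- A circulation in kilter, as long as the arc `k` has capacity `0`, turns into the starting
situation of an augmentation if this arc is filled. -/
theorem Tree.augmenting {E : Finset α} {V : Finset β} {t h : α → β} {w c f : α → ℤ} {p T : β → ℤ}
    {par : β → α} {k : α} {rank : β → ℕ} (ht : ∀ e ∈ E, t e ∈ V) (hk : k ∈ E) (hck : c k = 0)
    (hK : Kilter E t h w c f p) (hdiv : ∀ x ∈ V, divergence E t h f x = 0)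
    (hT : Tree E V t h w c f p T par (h k) rank) (hTk : 0 < T (t k))
    (hred : 0 ≤ reduced t h w p k) :
    Augmenting E V t h w (Function.update c k 1) (Function.update f k 1) p par (h k) (t k) T
      rank := by
  have hfk : f k = 0 := by
    have h1 := hK.nonneg k hk
    have h2 := hK.le_cap k hk
    omega
  refine ⟨⟨fun e he => ?_, fun e he => ?_, fun e he => ?_, fun e he => ?_⟩, ht k hk, hTk,
    fun x hx => ?_, fun z hz hTz hzv _ => ?_⟩
  · by_cases h' : e = k
    · subst h'; simp
    · simpa [h'] using hK.nonneg e he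
  · by_cases h' : e = k
    · subst h'; simp
    · simpa [h'] using hK.le_cap e he
  · by_cases h' : e = k
    · subst h'; simp
    · simpa [h'] using hK.of_lt e he
  · by_cases h' : e = k
    · subst h'; simpa using hred
    · simpa [h'] using hK.of_pos e he
  · rw [divergence_update hk, hdiv x hx, hfk]; ring
  · obtain ⟨a, b, y, hy, c1, c2, c3⟩ := hT.step z hz hTz hzv
    refine ⟨a, b, y, hy, c1, c2, ?_⟩
    -- With capacity and flow 0, the arc `k` is residual in neither direction and cannot belong to
    -- the tree.
    have hne : par z ≠ k := by
      intro h'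
      rw [h'] at c3
      rcases c3 with ⟨-, -, h3⟩ | ⟨-, -, h3⟩ <;> omega
    simpa [ResArc, hne] using c3

omit [DecidableEq β] in
/-- An arc whose reduced reward is not positive may get a positive capacity. -/
theorem Kilter.update_cap {E : Finset α} {t h : α → β} {w c f : α → ℤ} {p : β → ℤ} {k : α}
    (hk : k ∈ E) (hck : c k = 0) (hK : Kilter E t h w c f p) (hred : reduced t h w p k ≤ 0) :
    Kilter E t h w (Function.update c k 1) f p := by
  have hfk : f k = 0 := by
    have h1 := hK.nonneg k hk
    have h2 := hK.le_cap k hk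
    omega
  refine ⟨hK.nonneg, fun e he => ?_, fun e he => ?_, hK.of_pos⟩
  · by_cases h' : e = k
    · subst h'; simp [hfk]
    · simpa [h'] using hK.le_cap e he
  · by_cases h' : e = k
    · subst h'; intro _; exact hred
    · simpa [h'] using hK.of_lt e he

end Circulation

/-! ### The program for the circulation problem

Arrays: 1 tails, 2 heads, 3 capacities, 4 rewards, 5 flow, 6 potential, 7 marks of the nodes in the
tree, 8 arcs of the tree. Registers: 9 number of nodes, 16 number of arcs, 17 the arc to be
inserted. -/

namespace Stmt

/-- Branching on `a ≠ b`. -/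
def ifNe (a b : Expr) (p q : Stmt) : Stmt := cond (.sub a b) p (cond (.sub b a) p q)

theorem run_ifNe (a b : Expr) (p q : Stmt) (σ : State) :
    (ifNe a b p q).run σ = if a.val σ = b.val σ then q.run σ else p.run σ := by
  rcases lt_trichotomy (a.val σ) (b.val σ) with h | h | h
  · simp [ifNe, run, h, h.ne]
  · simp [ifNe, run, h]
  · simp [ifNe, run, h, h.ne']

end Stmt

open Stmt

/-- The reduced reward of the arc `e`. -/
def reducedExpr (e : Expr) : Expr :=
  .sub (.add (.arr 4 e) (.arr 6 (.arr 1 e))) (.arr 6 (.arr 2 e))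

/-- Comparing the slack of an arc with the smallest slack so far (register 20). -/
def scanBody : Stmt := block
  [assign 23 (.arr 1 (.reg 19)), assign 24 (.arr 2 (.reg 19)), assign 25 (reducedExpr (.reg 19)),
    whens [.arr 7 (.reg 23), .sub (.const 1) (.arr 7 (.reg 24)),
        .sub (.arr 3 (.reg 19)) (.arr 5 (.reg 19)), .add (.reg 20) (.reg 25)]
      (block [assign 20 (.sub (.const 0) (.reg 25)), assign 21 (.reg 19), assign 22 (.reg 24)]),
    whens [.arr 7 (.reg 24), .sub (.const 1) (.arr 7 (.reg 23)), .arr 5 (.reg 19),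
        .sub (.reg 20) (.reg 25)]
      (block [assign 20 (.reg 25), assign 21 (.reg 19), assign 22 (.reg 23)])]

/-- Finding a residual arc of minimum slack that leaves the tree. -/
def scan : Stmt := block
  -- Starting from the reduced reward of the new arc caps the raise. If no slack is strictly
  -- smaller, register 21 keeps the value -1 and the raise brings that reduced reward down to 0.
  [assign 20 (reducedExpr (.reg 17)), assign 21 (.const (-1)), upto 19 16 scanBody]

/-- Raising the potential on the tree. -/
def raise : Stmt := upto 19 9
  (cond (.arr 7 (.reg 19)) (aset 6 (.reg 19) (.add (.arr 6 (.reg 19)) (.reg 20))) skip)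

/-- Attaching the arc that has been found to the tree. -/
def attach : Stmt := cond (.add (.reg 21) (.const 1))
  (block [aset 7 (.reg 22) (.const 1), aset 8 (.reg 22) (.reg 21)]) skip

/-- One round of the growth of the tree. -/
def growBody : Stmt :=
  cond (.sub (.const 1) (.arr 7 (.arr 1 (.reg 17)))) (block [scan, raise, attach]) skip

/-- The tree that consists of the head of the arc to be inserted only. -/
def initTree : Stmt := block
  [upto 19 9 (aset 7 (.reg 19) (.const 0)), aset 7 (.arr 2 (.reg 17)) (.const 1)]

/-- One step of the augmentation, from the node in register 26 towards the root. -/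
def traceBody : Stmt := ifNe (.reg 26) (.arr 2 (.reg 17))
  (block [assign 27 (.arr 8 (.reg 26)),
    ifNe (.arr 2 (.reg 27)) (.reg 26)
      (block [aset 5 (.reg 27) (.sub (.arr 5 (.reg 27)) (.const 1)), assign 26 (.arr 2 (.reg 27))])
      (block [aset 5 (.reg 27) (.add (.arr 5 (.reg 27)) (.const 1)),
        assign 26 (.arr 1 (.reg 27))])]) skip

/-- The augmentation. -/
def augment : Stmt := cond (.arr 7 (.arr 1 (.reg 17)))
  (block [aset 5 (.reg 17) (.const 1), assign 26 (.arr 1 (.reg 17)), upto 18 9 traceBody]) skip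

/-- The insertion of an arc: its capacity changes from `0` to `1`. -/
def insertArc : Stmt := block
  [cond (reducedExpr (.reg 17)) (block [initTree, upto 18 9 growBody, augment]) skip,
    aset 3 (.reg 17) (.const 1)]

/-- The insertion of the first arcs, as many as register 0 says. -/
def solve : Stmt := block [upto 19 9 (aset 6 (.reg 19) (.const 0)), upto 17 0 insertArc]

/-! ### Correctness of the insertion of arcs -/

/-- The reduced reward in the given state. -/
def State.red (σ : State) (e : ℤ) : ℤ := reduced (σ.arr 1) (σ.arr 2) (σ.arr 4) (σ.arr 6) e

theorem val_reducedExpr (σ : State) (e : Expr) : (reducedExpr e).val σ = σ.red (e.val σ) := by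
  simp [reducedExpr, State.red, reduced]

/-- The flow is in kilter in the given state, with `m` arcs. -/
def State.Kilter (σ : State) (m : ℤ) : Prop :=
  ResourceAllocation.Kilter (Finset.Ico 0 m) (σ.arr 1) (σ.arr 2) (σ.arr 4) (σ.arr 3) (σ.arr 5)
    (σ.arr 6)

/-- `δ` is at most the slack of those of the first `k` arcs that leave the tree. -/
def State.LeSlack (σ : State) (δ k : ℤ) : Prop :=
  (∀ e ∈ Finset.Ico 0 k, 0 < σ.arr 7 (σ.arr 1 e) → ¬ 0 < σ.arr 7 (σ.arr 2 e) →
    σ.arr 5 e < σ.arr 3 e → δ ≤ -σ.red e) ∧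
  (∀ e ∈ Finset.Ico 0 k, 0 < σ.arr 7 (σ.arr 2 e) → ¬ 0 < σ.arr 7 (σ.arr 1 e) →
    0 < σ.arr 5 e → δ ≤ σ.red e)

/-- The arc `e` leaves the tree for the node `z`, with slack `δ`. -/
def State.Leaves (σ : State) (δ e z : ℤ) : Prop :=
  (0 < σ.arr 7 (σ.arr 1 e) ∧ ¬ 0 < σ.arr 7 z ∧ σ.arr 2 e = z ∧ σ.arr 5 e < σ.arr 3 e ∧
      δ = -σ.red e) ∨
  (0 < σ.arr 7 (σ.arr 2 e) ∧ ¬ 0 < σ.arr 7 z ∧ σ.arr 1 e = z ∧ 0 < σ.arr 5 e ∧ δ = σ.red e)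

theorem State.LeSlack.succ {σ : State} {δ δ' k : ℤ} (h : σ.LeSlack δ k) (hδ : δ' ≤ δ)
    (h1 : 0 < σ.arr 7 (σ.arr 1 k) → ¬ 0 < σ.arr 7 (σ.arr 2 k) → σ.arr 5 k < σ.arr 3 k →
      δ' ≤ -σ.red k)
    (h2 : 0 < σ.arr 7 (σ.arr 2 k) → ¬ 0 < σ.arr 7 (σ.arr 1 k) → 0 < σ.arr 5 k → δ' ≤ σ.red k) :
    σ.LeSlack δ' (k + 1) := by
  refine ⟨fun e he a b c => ?_, fun e he a b c => ?_⟩ <;>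
  · rw [Finset.mem_Ico] at he
    rcases eq_or_lt_of_le (Int.lt_add_one_iff.1 he.2) with rfl | h'
    · first | exact h1 a b c | exact h2 a b c
    · have := Finset.mem_Ico.2 ⟨he.1, h'⟩
      first | exact hδ.trans (h.1 e this a b c) | exact hδ.trans (h.2 e this a b c)

/-- The invariant is that register 20 is the minimum of the cap and of the slacks seen so far. It
stays nonnegative because slacks of residual arcs are nonnegative for a flow in kilter. -/
theorem scan_spec {σ : State} {m : ℤ} (hm : σ.reg 16 = m) (hm0 : 0 ≤ m) (hK : σ.Kilter m)
    (h0 : 0 ≤ σ.red (σ.reg 17)) :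
    0 ≤ (scan.run σ).reg 20 ∧ σ.LeSlack ((scan.run σ).reg 20) m ∧
      (((scan.run σ).reg 21 = -1 ∧ (scan.run σ).reg 20 = σ.red (σ.reg 17)) ∨
        (0 ≤ (scan.run σ).reg 21 ∧ (scan.run σ).reg 21 < m ∧
          (scan.run σ).reg 20 ≤ σ.red (σ.reg 17) ∧
          σ.Leaves ((scan.run σ).reg 20) ((scan.run σ).reg 21) ((scan.run σ).reg 22))) := by
  have key := run_upto_induction (i := 19) (n := 16) (p := scanBody)
    (σ := (σ.setReg 20 (σ.red (σ.reg 17))).setReg 21 (-1)) (c := m)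
    (fun k τ => τ.arr = σ.arr ∧ 0 ≤ τ.reg 20 ∧ τ.reg 20 ≤ σ.red (σ.reg 17) ∧
      σ.LeSlack (τ.reg 20) k ∧
      ((τ.reg 21 = -1 ∧ τ.reg 20 = σ.red (σ.reg 17)) ∨
        (0 ≤ τ.reg 21 ∧ τ.reg 21 < m ∧ σ.Leaves (τ.reg 20) (τ.reg 21) (τ.reg 22))))
    (by simpa using hm) hm0 ?_ ?_
  · have e1 : scan.run σ = (upto 19 16 scanBody).run
        ((σ.setReg 20 (σ.red (σ.reg 17))).setReg 21 (-1)) := by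
      simp only [scan, block, run, val_reducedExpr, Expr.val_reg, Expr.val_const]
    rw [← e1] at key
    obtain ⟨-, h1, h2, h3, h4⟩ := key
    refine ⟨h1, h3, h4.imp_right fun h => ⟨h.1, h.2.1, h2, h.2.2⟩⟩
  · refine ⟨by simp, by simpa using h0, by simp, ?_, Or.inl (by simp)⟩
    constructor <;> intro e he <;> simp at he
  · rintro k τ hk0 hkm hk ⟨ha, hd0, hd, hs, hb⟩
    have hke : k ∈ Finset.Ico 0 m := Finset.mem_Ico.2 ⟨hk0, hkm⟩
    have hlt := hK.of_lt k hke
    have hpos := hK.of_pos k hke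
    change _ → σ.red k ≤ 0 at hlt
    change _ → 0 ≤ σ.red k at hpos
    have hred : ∀ υ : State, υ.arr = σ.arr → υ.red = σ.red := by
      intro υ h; funext e; simp only [State.red, h]
    obtain ⟨υ, hυ⟩ : ∃ υ, scanBody.run τ = υ := ⟨_, rfl⟩
    rw [hυ]
    by_cases hF : 0 < σ.arr 7 (σ.arr 1 k) ∧ σ.arr 7 (σ.arr 2 k) < 1 ∧ σ.arr 5 k < σ.arr 3 k ∧
        0 < τ.reg 20 + σ.red k
    · have hT : ¬ 0 < σ.arr 7 (σ.arr 2 k) := by omega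
      simp [scanBody, block, run, val_reducedExpr, hk, ha, run_whens, hred, hF, hT] at hυ
      subst hυ
      have := hlt hF.2.2.1
      refine ⟨by simp [ha], by simp; omega, by simp; omega, ?_, Or.inr ⟨by simpa, by simpa, ?_⟩⟩
      · exact hs.succ (by simp; omega) (fun _ _ _ => by simp) (fun h => absurd h hT)
      · exact Or.inl (by simpa using ⟨hF.1, by omega, hF.2.2.1⟩)
    · simp [scanBody, block, run, val_reducedExpr, hk, ha, run_whens, hred, hF] at hυ
      by_cases hB : 0 < σ.arr 7 (σ.arr 2 k) ∧ σ.arr 7 (σ.arr 1 k) < 1 ∧ 0 < σ.arr 5 k ∧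
          σ.red k < τ.reg 20
      · have hT : ¬ 0 < σ.arr 7 (σ.arr 1 k) := by omega
        simp [hB] at hυ
        subst hυ
        have := hpos hB.2.2.1
        refine ⟨by simp [ha], by simpa, by simp; omega, ?_, Or.inr ⟨by simpa, by simpa, ?_⟩⟩
        · exact hs.succ (by simp; omega) (fun h => absurd h hT) (fun _ _ _ => by simp)
        · exact Or.inr (by simpa using ⟨hB.1, by omega, hB.2.2.1⟩)
      · rw [if_neg hB] at hυ
        subst hυ
        refine ⟨by simp [ha], by simpa, by simpa, ?_, by simpa using hb⟩
        refine hs.succ (by simp) (fun a b c => ?_) (fun a b c => ?_)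
        · have := fun d => hF ⟨a, by omega, c, d⟩
          simp
          omega
        · have := fun d => hB ⟨a, by omega, c, d⟩
          simp
          omega

theorem raise_spec {σ : State} {N : ℤ} (hN : σ.reg 9 = N) (hN0 : 0 ≤ N) :
    ∀ x ∈ Finset.Ico 0 N, (raise.run σ).arr 6 x =
      if 0 < σ.arr 7 x then σ.arr 6 x + σ.reg 20 else σ.arr 6 x := by
  have key := run_upto_induction (i := 19) (n := 9) (σ := σ) (c := N)
    (p := cond (.arr 7 (.reg 19)) (aset 6 (.reg 19) (.add (.arr 6 (.reg 19)) (.reg 20))) skip)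
    (fun k τ => τ.arr 7 = σ.arr 7 ∧ τ.reg 20 = σ.reg 20 ∧ ∀ x, τ.arr 6 x =
      if 0 ≤ x ∧ x < k ∧ 0 < σ.arr 7 x then σ.arr 6 x + σ.reg 20 else σ.arr 6 x)
    hN hN0 ?_ ?_
  · intro x hx
    rw [Finset.mem_Ico] at hx
    have h := key.2.2 x
    simp only [hx, true_and] at h
    exact h
  · refine ⟨by simp, by simp, fun x => ?_⟩
    rw [if_neg (by omega)]
    simp
  · rintro k τ hk0 hkN hk ⟨h7, h20, h6⟩
    by_cases hT : 0 < σ.arr 7 k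
    · simp only [run, Expr.val_arr, Expr.val_reg, hk, h7, hT, if_true, Expr.val_add]
      refine ⟨by simp [h7], by simp [h20], fun x => ?_⟩
      by_cases hx : x = k
      · subst hx; simp [h6, h20, hk0, hT]
      · have : x < k + 1 ↔ x < k := by omega
        simp [hx, h6, this]
    · simp only [run, Expr.val_arr, Expr.val_reg, hk, h7, hT, if_false]
      refine ⟨by simp [h7], by simp [h20], fun x => ?_⟩
      by_cases hx : x = k
      · subst hx; simp [h6, hT]
      · have : x < k + 1 ↔ x < k := by omega
        simp [h6, this]

theorem initTree_spec {σ : State} {N : ℤ} (hN : σ.reg 9 = N) (hN0 : 0 ≤ N) :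
    ∀ x ∈ Finset.Ico 0 N, (initTree.run σ).arr 7 x =
      if x = σ.arr 2 (σ.reg 17) then 1 else 0 := by
  have key := run_upto_induction (i := 19) (n := 9) (σ := σ) (c := N)
    (p := aset 7 (.reg 19) (.const 0))
    (fun k τ => τ.arr 2 = σ.arr 2 ∧ τ.reg 17 = σ.reg 17 ∧
      ∀ x ∈ Finset.Ico 0 k, τ.arr 7 x = 0) hN hN0 (by simp) ?_
  · intro x hx
    change ((aset 7 (.arr 2 (.reg 17)) (.const 1)).run
      ((upto 19 9 (aset 7 (.reg 19) (.const 0))).run σ)).arr 7 x = _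
    generalize (upto 19 9 (aset 7 (.reg 19) (.const 0))).run σ = υ at key ⊢
    obtain ⟨h2, h17, h7⟩ := key
    by_cases h : x = σ.arr 2 (σ.reg 17)
    · simp [run, h2, h17, h]
    · simp [run, h2, h17, h, h7 x hx]
  · rintro k τ hk0 hkN hk ⟨h2, h17, h7⟩
    refine ⟨by simp [run, h2], by simp [run, h17], fun x hx => ?_⟩
    rw [Finset.mem_Ico] at hx
    by_cases h : x = k
    · simp [run, hk, h]
    · simpa [run, hk, h] using h7 x (Finset.mem_Ico.2 ⟨hx.1, by omega⟩)

/-- The sizes of the network with `m` arcs and `N` nodes are in the registers, the arcs connect nodes,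
and the arc to be inserted exists. -/
structure State.Sized (σ : State) (m N : ℤ) : Prop where
  arcs : σ.reg 16 = m
  nodes : σ.reg 9 = N
  nodes_nonneg : 0 ≤ N
  tail : ∀ e ∈ Finset.Ico 0 m, σ.arr 1 e ∈ Finset.Ico 0 N
  head : ∀ e ∈ Finset.Ico 0 m, σ.arr 2 e ∈ Finset.Ico 0 N
  mem : σ.reg 17 ∈ Finset.Ico 0 m

theorem State.Sized.run {σ : State} {m N : ℤ} (h : σ.Sized m N) {s : Stmt}
    (h9 : 9 ∉ s.writes) (h16 : 16 ∉ s.writes) (h17 : 17 ∉ s.writes) (h1 : 1 ∉ s.stores)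
    (h2 : 2 ∉ s.stores) : (s.run σ).Sized m N := by
  refine ⟨?_, ?_, h.nodes_nonneg, ?_, ?_, ?_⟩
  · rw [reg_run_of_notMem h16, h.arcs]
  · rw [reg_run_of_notMem h9, h.nodes]
  · rw [arr_run_of_notMem h1]; exact h.tail
  · rw [arr_run_of_notMem h2]; exact h.head
  · rw [reg_run_of_notMem h17]; exact h.mem

/-- The state after `i` rounds of growth of the tree. -/
structure State.Growing (σ : State) (m N i : ℤ) : Prop where
  sized : σ.Sized m N
  kilter : σ.Kilter m
  red_nonneg : 0 ≤ σ.red (σ.reg 17)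
  tree : ∃ rank, Tree (Finset.Ico 0 m) (Finset.Ico 0 N) (σ.arr 1) (σ.arr 2) (σ.arr 4) (σ.arr 3)
    (σ.arr 5) (σ.arr 6) (σ.arr 7) (σ.arr 8) (σ.arr 2 (σ.reg 17)) rank ∧
    ∀ x ∈ Finset.Ico 0 N, 0 < σ.arr 7 x → rank x ≤ i.toNat
  -- The tree starts with one node. For `i = N` the third alternative would need `N + 1` nodes out
  -- of `N`, so one of the first two holds.
  progress : 0 < σ.arr 7 (σ.arr 1 (σ.reg 17)) ∨ σ.red (σ.reg 17) = 0 ∨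
    i + 1 ≤ ({x ∈ Finset.Ico 0 N | 0 < σ.arr 7 x} : Finset ℤ).card

/-- After the raise, either the arc found has reduced reward 0 and can be attached, or the cap was
decisive and the arc to be inserted has reduced reward 0. Raising by at most the cap keeps the
latter reduced reward nonnegative. -/
theorem State.Growing.next {τ : State} {m N i : ℤ} (h : τ.Growing m N i) (hi : 0 ≤ i) :
    (growBody.run τ).Growing m N (i + 1) := by
  obtain ⟨rank, hT, hr⟩ := h.tree
  by_cases hk : 0 < τ.arr 7 (τ.arr 1 (τ.reg 17))
  · have e1 : growBody.run τ = τ := by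
      simp only [growBody, run, Expr.val_sub, Expr.val_const, Expr.val_arr, Expr.val_reg]
      rw [if_neg (by omega)]
    rw [e1]
    refine ⟨h.sized, h.kilter, h.red_nonneg, ⟨rank, hT, fun x hx hTx => ?_⟩, .inl hk⟩
    have := hr x hx hTx
    omega
  · have e1 : growBody.run τ = attach.run (raise.run (scan.run τ)) := by
      simp only [growBody, run, Expr.val_sub, Expr.val_const, Expr.val_arr, Expr.val_reg]
      rw [if_pos (by omega)]
      rfl
    have hsz := h.sized
    obtain ⟨s0, sslack, sres⟩ := scan_spec hsz.arcs (by
      have := Finset.mem_Ico.1 hsz.mem; omega) h.kilter h.red_nonneg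
    have harr : (scan.run τ).arr = τ.arr := by
      funext j; exact arr_run_of_notMem (by simp [scan, scanBody, block, stores, whens]) τ
    have hsz1 : (scan.run τ).Sized m N :=
      hsz.run (by decide) (by decide) (by decide) (by decide) (by decide)
    have hrs := raise_spec hsz1.nodes hsz.nodes_nonneg
    have h17 : (scan.run τ).reg 17 = τ.reg 17 := reg_run_of_notMem (by decide) τ
    rw [e1]
    generalize scan.run τ = σ₁ at *
    have hsz2 : (raise.run σ₁).Sized m N :=
      hsz1.run (by decide) (by decide) (by decide) (by decide) (by decide)
    have f : ∀ j : Fin 16, j ≠ 6 → (raise.run σ₁).arr j = τ.arr j := by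
      intro j hj
      rw [← harr]
      exact arr_run_of_notMem (by simpa [raise, stores] using hj) _
    have g20 : (raise.run σ₁).reg 20 = σ₁.reg 20 := reg_run_of_notMem (by decide) σ₁
    have g21 : (raise.run σ₁).reg 21 = σ₁.reg 21 := reg_run_of_notMem (by decide) σ₁
    have g22 : (raise.run σ₁).reg 22 = σ₁.reg 22 := reg_run_of_notMem (by decide) σ₁
    have g17 : (raise.run σ₁).reg 17 = τ.reg 17 := by
      rw [← h17]; exact reg_run_of_notMem (by decide) σ₁
    generalize raise.run σ₁ = σ₂ at *
    rw [harr] at hrs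
    have hK2 : σ₂.Kilter m := by
      have := Kilter.raise hsz.tail hsz.head h.kilter s0 hrs sslack.1 sslack.2
      simpa only [State.Kilter, f 1 (by decide), f 2 (by decide), f 3 (by decide),
        f 4 (by decide), f 5 (by decide)] using this
    have hT2 := hT.raise hrs
    -- The head of the arc to be inserted is the root and is raised; its tail is not yet in the
    -- tree.
    have hred2 : σ₂.red (τ.reg 17) = τ.red (τ.reg 17) - σ₁.reg 20 := by
      simp only [State.red, reduced, f 1 (by decide), f 2 (by decide), f 4 (by decide)]
      rw [hrs _ (hsz.tail _ hsz.mem), hrs _ (hsz.head _ hsz.mem), if_neg hk, if_pos hT.root]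
      ring
    rcases sres with ⟨hb, hδ⟩ | ⟨hb0, hbm, hδ, hL⟩
    · have e2 : attach.run σ₂ = σ₂ := by
        simp only [attach, run, Expr.val_add, Expr.val_const, Expr.val_reg, g21, hb]
        rfl
      rw [e2]
      refine ⟨hsz2, hK2, by rw [g17, hred2]; omega, ⟨rank, ?_, fun x hx hTx => ?_⟩, ?_⟩
      · simpa only [g17, f 1 (by decide), f 2 (by decide), f 3 (by decide), f 4 (by decide),
          f 5 (by decide), f 7 (by decide), f 8 (by decide)] using hT2
      · rw [f 7 (by decide)] at hTx
        have := hr x hx hTx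
        omega
      · rw [g17, hred2]; exact .inr (.inl (by omega))
    · have e2 : attach.run σ₂ = (σ₂.setArr 7 (σ₁.reg 22) 1).setArr 8 (σ₁.reg 22) (σ₁.reg 21) := by
        simp only [attach, run, Expr.val_add, Expr.val_const, Expr.val_reg, g21]
        rw [if_pos (by omega)]
        simp [block, run, g21, g22]
      have hsz3 : (attach.run σ₂).Sized m N :=
        hsz2.run (by decide) (by decide) (by decide) (by decide) (by decide)
      rw [e2] at hsz3 ⊢
      set e := σ₁.reg 21
      set z := σ₁.reg 22
      have he : e ∈ Finset.Ico 0 m := Finset.mem_Ico.2 ⟨hb0, hbm⟩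
      have hTz : ¬ 0 < τ.arr 7 z := by rcases hL with hL | hL <;> exact hL.2.1
      obtain ⟨x, hx, hTx, harc, hz, hred0⟩ : ∃ x ∈ Finset.Ico 0 N, 0 < τ.arr 7 x ∧
          ResArc (τ.arr 1) (τ.arr 2) (τ.arr 3) (τ.arr 5) e x z ∧ z ∈ Finset.Ico 0 N ∧
          reduced (τ.arr 1) (τ.arr 2) (τ.arr 4) (σ₂.arr 6) e = 0 := by
        rcases hL with ⟨a1, a2, a3, a4, a5⟩ | ⟨a1, a2, a3, a4, a5⟩
        · refine ⟨_, hsz.tail e he, a1, .inl ⟨rfl, a3, a4⟩, a3 ▸ hsz.head e he, ?_⟩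
          rw [reduced, hrs _ (hsz.tail e he), hrs _ (hsz.head e he), a3, if_pos a1, if_neg a2, a5,
            State.red, reduced, a3]
          ring
        · refine ⟨_, hsz.head e he, a1, .inr ⟨rfl, a3, a4⟩, a3 ▸ hsz.tail e he, ?_⟩
          rw [reduced, hrs _ (hsz.tail e he), hrs _ (hsz.head e he), a3, if_pos a1, if_neg a2, a5,
            State.red, reduced, a3]
          ring
      obtain ⟨hT3, hr3⟩ := hT2.grow hr he hx hTx hTz harc hred0
      refine ⟨hsz3, ?_, ?_, ⟨Function.update rank z (i.toNat + 1), ?_, ?_⟩, ?_⟩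
      · simpa [State.Kilter] using hK2
      · have : σ₂.red (τ.reg 17) = ((σ₂.setArr 7 z 1).setArr 8 z e).red (τ.reg 17) := by
          simp [State.red]
        simp only [State.reg_setArr, g17, ← this, hred2]
        omega
      · simpa [g17, f] using hT3
      · have e3 : (i + 1).toNat = i.toNat + 1 := by omega
        simpa [f, e3] using hr3
      · rcases h.progress with h' | h' | h'
        · exact absurd h' hk
        · right; left
          have : σ₂.red (τ.reg 17) = ((σ₂.setArr 7 z 1).setArr 8 z e).red (τ.reg 17) := by
            simp [State.red]
          simp only [State.reg_setArr, g17, ← this, hred2]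
          omega
        · right; right
          have hsub : insert z ({x ∈ Finset.Ico 0 N | 0 < τ.arr 7 x} : Finset ℤ) ⊆
              {x ∈ Finset.Ico 0 N | 0 < ((σ₂.setArr 7 z 1).setArr 8 z e).arr 7 x} := by
            intro y hy
            rw [Finset.mem_insert, Finset.mem_filter] at hy
            rw [Finset.mem_filter]
            by_cases hyz : y = z
            · subst hyz; exact ⟨hz, by simp⟩
            · obtain ⟨y1, y2⟩ := hy.resolve_left hyz
              exact ⟨y1, by simpa [hyz, f] using y2⟩
          have hc := Finset.card_le_card hsub
          rw [Finset.card_insert_of_notMem (by simp [hTz])] at hc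
          omega

theorem State.Growing.setReg {τ : State} {m N i : ℤ} (h : τ.Growing m N i) {x : ℕ} (h9 : 9 ≠ x)
    (h16 : 16 ≠ x) (h17 : 17 ≠ x) (v : ℤ) : (τ.setReg x v).Growing m N i := by
  obtain ⟨⟨a1, a2, a3, a4, a5, a6⟩, b, c, d, e⟩ := h
  refine ⟨⟨?_, ?_, a3, a4, a5, ?_⟩, b, ?_, ?_, ?_⟩
  · simpa [h16] using a1
  · simpa [h9] using a2
  · simpa [h17] using a6
  · rw [State.reg_setReg_of_ne _ h17]; exact c
  · simpa [h17] using d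
  · rw [State.reg_setReg_of_ne _ h17]; exact e

theorem grow_spec {σ : State} {m N : ℤ} (hsz : σ.Sized m N) (hK : σ.Kilter m)
    (h0 : 0 ≤ σ.red (σ.reg 17)) :
    ((upto 18 9 growBody).run (initTree.run σ)).Growing m N N := by
  have hsz1 : (initTree.run σ).Sized m N :=
    hsz.run (by decide) (by decide) (by decide) (by decide) (by decide)
  have hin := initTree_spec hsz.nodes hsz.nodes_nonneg
  have f : ∀ j : Fin 16, j ≠ 7 → (initTree.run σ).arr j = σ.arr j := fun j hj =>
    arr_run_of_notMem (by simpa [initTree, block, stores] using hj) _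
  have g17 : (initTree.run σ).reg 17 = σ.reg 17 := reg_run_of_notMem (by decide) σ
  generalize initTree.run σ = τ at *
  have hv := hsz.head _ hsz.mem
  have hred : τ.red = σ.red := by
    funext e
    simp only [State.red, f 1 (by decide), f 2 (by decide), f 4 (by decide), f 6 (by decide)]
  refine run_upto_induction (fun i υ => υ.Growing m N i) hsz1.nodes hsz.nodes_nonneg ?_ ?_
  · refine State.Growing.setReg ⟨hsz1, ?_, by rw [hred, g17]; exact h0, ⟨fun _ => 0, ⟨?_, ?_⟩, ?_⟩,
      ?_⟩ (by decide) (by decide) (by decide) 0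
    · simpa [State.Kilter, f] using hK
    · rw [f 2 (by decide), g17, hin _ hv]; simp
    · intro z hz hTz hne
      rw [f 2 (by decide), g17] at hne
      rw [hin z hz, if_neg hne] at hTz
      omega
    · intro x _ _; simp
    · right; right
      have : 0 < ({x ∈ Finset.Ico 0 N | 0 < τ.arr 7 x} : Finset ℤ).card :=
        Finset.card_pos.2 ⟨_, Finset.mem_filter.2 ⟨hv, by rw [hin _ hv]; simp⟩⟩
      omega
  · intro i υ hi0 _ _ h
    exact (h.next hi0).setReg (by decide) (by decide) (by decide) _

/-- The flow is a circulation in kilter, after the insertion of the arc `k`. -/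
def State.Inserted (σ : State) (m N k : ℤ) : Prop :=
  ResourceAllocation.Kilter (Finset.Ico 0 m) (σ.arr 1) (σ.arr 2) (σ.arr 4)
    (Function.update (σ.arr 3) k 1) (σ.arr 5) (σ.arr 6) ∧
  ∀ x ∈ Finset.Ico 0 N, divergence (Finset.Ico 0 m) (σ.arr 1) (σ.arr 2) (σ.arr 5) x = 0

/-- Filling the arc creates a surplus at its tail and a deficit at the root, and the walk down the
tree carries the surplus to the root. The rank is at most `N` initially and drops in every round, so
`N` rounds suffice. -/
theorem augment_spec {σ : State} {m N : ℤ} (hG : σ.Growing m N N)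
    (hdiv : ∀ x ∈ Finset.Ico 0 N, divergence (Finset.Ico 0 m) (σ.arr 1) (σ.arr 2) (σ.arr 5) x = 0)
    (hc : σ.arr 3 (σ.reg 17) = 0) : (augment.run σ).Inserted m N (σ.reg 17) := by
  obtain ⟨rank, hT, hr⟩ := hG.tree
  have hsz := hG.sized
  by_cases hk : 0 < σ.arr 7 (σ.arr 1 (σ.reg 17))
  · have e1 : augment.run σ = (upto 18 9 traceBody).run
        ((σ.setArr 5 (σ.reg 17) 1).setReg 26 (σ.arr 1 (σ.reg 17))) := by
      simp only [augment, run, Expr.val_arr, Expr.val_reg, hk, if_true, block]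
      simp
    have key := run_upto_induction (i := 18) (n := 9) (p := traceBody) (c := N)
      (σ := (σ.setArr 5 (σ.reg 17) 1).setReg 26 (σ.arr 1 (σ.reg 17)))
      (fun i υ => (∀ j : Fin 16, j ≠ 5 → υ.arr j = σ.arr j) ∧ υ.reg 17 = σ.reg 17 ∧
        Augmenting (Finset.Ico 0 m) (Finset.Ico 0 N) (σ.arr 1) (σ.arr 2) (σ.arr 4)
          (Function.update (σ.arr 3) (σ.reg 17) 1) (υ.arr 5) (σ.arr 6) (σ.arr 8)
          (σ.arr 2 (σ.reg 17)) (υ.reg 26) (σ.arr 7) rank ∧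
        (υ.reg 26 = σ.arr 2 (σ.reg 17) ∨ rank (υ.reg 26) + i ≤ N))
      (by simpa using hsz.nodes) hsz.nodes_nonneg ?_ ?_
    · rw [← e1] at key
      generalize augment.run σ = υ at *
      obtain ⟨f, g17, hA, hcur⟩ := key
      -- Away from the root the rank would now be 0, leaving no rank for a predecessor.
      have hend : υ.reg 26 = σ.arr 2 (σ.reg 17) := by
        by_contra hne
        obtain ⟨-, -, x, -, -, hx, -⟩ := hA.step _ hA.mem hA.pos hne le_rfl
        have := hcur.resolve_left hne
        omega
      refine ⟨?_, fun x hx => ?_⟩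
      · simpa [f] using hA.kilter
      · have := hA.div x hx
        rw [hend, sub_self] at this
        simpa [f] using this
    · have hA := Tree.augmenting hsz.tail hsz.mem hc hG.kilter hdiv hT hk hG.red_nonneg
      refine ⟨fun j hj => by simp [hj], by simp, by simpa using hA, .inr ?_⟩
      have h0 := hsz.nodes_nonneg
      have := hr _ (hsz.tail _ hsz.mem) hk
      simp only [State.reg_setReg_of_ne, State.reg_setReg_self, ne_eq, Nat.reduceEqDiff,
        not_false_eq_true]
      omega
    · rintro i υ hi0 hiN hi ⟨f, g17, hA, hcur⟩
      by_cases hne : υ.reg 26 = σ.arr 2 (σ.reg 17)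
      · have e2 : traceBody.run υ = υ := by
          simp [traceBody, run_ifNe, g17, f, hne, run]
        rw [e2]
        exact ⟨by simpa using f, by simpa using g17, by simpa using hA, .inl (by simpa using hne)⟩
      · obtain ⟨hA', hlt⟩ := hA.next hne rfl rfl
        have hcur' := hcur.resolve_left hne
        by_cases hh : σ.arr 2 (σ.arr 8 (υ.reg 26)) = υ.reg 26
        · have e2 : traceBody.run υ = ((υ.setReg 27 (σ.arr 8 (υ.reg 26))).setArr 5
              (σ.arr 8 (υ.reg 26)) (υ.arr 5 (σ.arr 8 (υ.reg 26)) + 1)).setReg 26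
                (σ.arr 1 (σ.arr 8 (υ.reg 26))) := by
            simp [traceBody, run_ifNe, g17, f, hne, block, run, hh]
          rw [if_pos hh] at hA' hlt
          rw [if_pos hh] at hA'
          rw [e2]
          refine ⟨fun j hj => by simpa [hj] using f j hj, by simpa using g17, by simpa using hA',
            .inr ?_⟩
          simp only [State.reg_setReg_of_ne, State.reg_setReg_self, ne_eq, Nat.reduceEqDiff,
            not_false_eq_true]
          omega
        · have e2 : traceBody.run υ = ((υ.setReg 27 (σ.arr 8 (υ.reg 26))).setArr 5
              (σ.arr 8 (υ.reg 26)) (υ.arr 5 (σ.arr 8 (υ.reg 26)) - 1)).setReg 26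
                (σ.arr 2 (σ.arr 8 (υ.reg 26))) := by
            simp [traceBody, run_ifNe, g17, f, hne, block, run, hh]
          rw [if_neg hh] at hA' hlt
          rw [if_neg hh] at hA'
          rw [e2]
          refine ⟨fun j hj => by simpa [hj] using f j hj, by simpa using g17, by simpa using hA',
            .inr ?_⟩
          simp only [State.reg_setReg_of_ne, State.reg_setReg_self, ne_eq, Nat.reduceEqDiff,
            not_false_eq_true]
          omega
  · have e1 : augment.run σ = σ := by
      simp only [augment, run, Expr.val_arr, Expr.val_reg, hk, if_false]
    rw [e1]
    -- The tail was not reached and the tree cannot have more than `N` nodes. So the reduced reward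
    -- is 0 and the opened arc may stay empty.
    have hred : σ.red (σ.reg 17) = 0 := by
      rcases hG.progress with h | h | h
      · exact absurd h hk
      · exact h
      · have h1 := Finset.card_filter_le (Finset.Ico 0 N) (fun x => 0 < σ.arr 7 x)
        rw [Int.card_Ico] at h1
        have := hsz.nodes_nonneg
        omega
    exact ⟨hG.kilter.update_cap hsz.mem hc hred.le, hdiv⟩

theorem insertArc_spec {σ : State} {m N : ℤ} (hsz : σ.Sized m N) (hK : σ.Kilter m)
    (hdiv : ∀ x ∈ Finset.Ico 0 N, divergence (Finset.Ico 0 m) (σ.arr 1) (σ.arr 2) (σ.arr 5) x = 0)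
    (hc : σ.arr 3 (σ.reg 17) = 0) :
    (insertArc.run σ).arr 3 = Function.update (σ.arr 3) (σ.reg 17) 1 ∧
      (insertArc.run σ).Kilter m ∧
      ∀ x ∈ Finset.Ico 0 N, divergence (Finset.Ico 0 m) ((insertArc.run σ).arr 1)
        ((insertArc.run σ).arr 2) ((insertArc.run σ).arr 5) x = 0 := by
  obtain ⟨τ, h1, h2, h3, h4⟩ : ∃ τ : State, insertArc.run σ = τ.setArr 3 (τ.reg 17) 1 ∧
      τ.reg 17 = σ.reg 17 ∧ τ.arr 3 = σ.arr 3 ∧ τ.Inserted m N (σ.reg 17) := by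
    refine ⟨(cond (reducedExpr (.reg 17)) (block [initTree, upto 18 9 growBody, augment])
      skip).run σ, rfl, reg_run_of_notMem (by decide) σ, arr_run_of_notMem (by decide) σ, ?_⟩
    simp only [run.eq_6, val_reducedExpr, Expr.val_reg]
    split_ifs with hr
    · have hG := grow_spec hsz hK hr.le
      have e17 : ((upto 18 9 growBody).run (initTree.run σ)).reg 17 = σ.reg 17 := by
        rw [reg_run_of_notMem (by decide), reg_run_of_notMem (by decide)]
      have f : ∀ j : Fin 16, j ≠ 6 → j ≠ 7 → j ≠ 8 →
          ((upto 18 9 growBody).run (initTree.run σ)).arr j = σ.arr j := by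
        intro j h6 h7 h8
        rw [arr_run_of_notMem, arr_run_of_notMem]
        · simp [initTree, block, stores, h7]
        · simp [growBody, scan, scanBody, raise, attach, whens, block, stores, h6, h7, h8]
      have := augment_spec hG (by simpa [f] using hdiv) (by simpa [f, e17] using hc)
      rw [e17] at this
      exact this
    · exact ⟨hK.update_cap hsz.mem hc (not_lt.1 hr), hdiv⟩
  rw [h1, h2]
  refine ⟨by simp [h3], ?_, ?_⟩
  · simpa [State.Kilter] using h4.1
  · simpa using h4.2

/-- Only the first `n` arcs may have a nonzero reward, and they start with capacity 0. Hence zero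
flow and zero potential are in kilter at the start, and `insertArc_spec` preserves this for each arc
in turn. -/
theorem solve_spec {σ : State} {n m N : ℤ} (h0 : σ.reg 0 = n) (hn0 : 0 ≤ n) (hnm : n ≤ m)
    (h16 : σ.reg 16 = m) (h9 : σ.reg 9 = N) (hN : 0 ≤ N)
    (ht : ∀ e ∈ Finset.Ico 0 m, σ.arr 1 e ∈ Finset.Ico 0 N)
    (hh : ∀ e ∈ Finset.Ico 0 m, σ.arr 2 e ∈ Finset.Ico 0 N)
    (hc0 : ∀ e ∈ Finset.Ico 0 n, σ.arr 3 e = 0) (hc : ∀ e ∈ Finset.Ico 0 m, 0 ≤ σ.arr 3 e)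
    (hw : ∀ e ∈ Finset.Ico n m, σ.arr 4 e = 0) (hf : ∀ e ∈ Finset.Ico 0 m, σ.arr 5 e = 0) :
    (∀ e, (solve.run σ).arr 3 e = if 0 ≤ e ∧ e < n then 1 else σ.arr 3 e) ∧
      (solve.run σ).Kilter m ∧
      ∀ x ∈ Finset.Ico 0 N, divergence (Finset.Ico 0 m) (σ.arr 1) (σ.arr 2)
        ((solve.run σ).arr 5) x = 0 := by
  have hp := run_upto_induction (i := 19) (n := 9) (σ := σ) (c := N)
    (p := aset 6 (.reg 19) (.const 0)) (fun k τ => ∀ x ∈ Finset.Ico 0 k, τ.arr 6 x = 0) h9 hN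
    (by simp) (by
      rintro k τ hk0 hkN hk h6 x hx
      rw [Finset.mem_Ico] at hx
      by_cases h : x = k
      · simp [run, hk, h]
      · simpa [run, hk, h] using h6 x (Finset.mem_Ico.2 ⟨hx.1, by omega⟩))
  have e1 : solve.run σ = (upto 17 0 insertArc).run
    ((upto 19 9 (aset 6 (.reg 19) (.const 0))).run σ) := rfl
  have f : ∀ j : Fin 16, j ≠ 6 →
      ((upto 19 9 (aset 6 (.reg 19) (.const 0))).run σ).arr j = σ.arr j := fun j hj =>
    arr_run_of_notMem (by simpa [stores] using hj) _
  have g : ∀ x, x ≠ 19 → ((upto 19 9 (aset 6 (.reg 19) (.const 0))).run σ).reg x = σ.reg x :=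
    fun x hx => reg_run_of_notMem (by simpa [writes] using hx) _
  rw [e1]
  generalize (upto 19 9 (aset 6 (.reg 19) (.const 0))).run σ = τ at *
  have key := run_upto_induction (i := 17) (n := 0) (σ := τ) (c := n) (p := insertArc)
    (fun k υ => υ.arr 1 = σ.arr 1 ∧ υ.arr 2 = σ.arr 2 ∧ υ.reg 9 = N ∧ υ.reg 16 = m ∧
      (∀ e, υ.arr 3 e = if 0 ≤ e ∧ e < k then 1 else σ.arr 3 e) ∧ υ.Kilter m ∧
      ∀ x ∈ Finset.Ico 0 N, divergence (Finset.Ico 0 m) (υ.arr 1) (υ.arr 2) (υ.arr 5) x = 0)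
    (by rw [g 0 (by decide), h0]) hn0 ?_ ?_
  · obtain ⟨a1, a2, -, -, a3, a4, a5⟩ := key
    exact ⟨a3, a4, by simpa [a1, a2] using a5⟩
  · refine ⟨by simp [f], by simp [f], by simp [g, h9], by simp [g, h16], fun e => ?_, ⟨?_, ?_, ?_, ?_⟩,
      fun x _ => ?_⟩
    · rw [if_neg (by omega)]; simp [f]
    · intro e he; simp [f, hf e he]
    · intro e he; simp [f, hf e he, hc e he]
    · intro e he hlt
      simp only [State.arr_setReg, f 1 (by decide), f 2 (by decide), f 3 (by decide),
        f 4 (by decide), f 5 (by decide), hf e he, reduced, hp _ (ht e he), hp _ (hh e he)] at hlt ⊢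
      rw [Finset.mem_Ico] at he
      rcases lt_or_ge e n with h | h
      · rw [hc0 e (Finset.mem_Ico.2 ⟨he.1, h⟩)] at hlt; omega
      · rw [hw e (Finset.mem_Ico.2 ⟨h, he.2⟩)]; simp
    · intro e he hlt
      simp [f, hf e he] at hlt
    · refine Finset.sum_eq_zero fun e he => ?_
      simp [f, hf e he]
  · rintro k υ hk0 hkn hk ⟨a1, a2, a3, a4, a5, a6, a7⟩
    have hsz : υ.Sized m N := ⟨a4, a3, hN, by rwa [a1], by rwa [a2],
      by rw [hk]; exact Finset.mem_Ico.2 ⟨hk0, by omega⟩⟩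
    obtain ⟨b1, b2, b3⟩ := insertArc_spec hsz a6 a7 (by
      rw [hk, a5, if_neg (by omega)]; exact hc0 k (Finset.mem_Ico.2 ⟨hk0, hkn⟩))
    refine ⟨?_, ?_, ?_, ?_, fun e => ?_, b2, b3⟩
    · rw [← a1]; exact arr_run_of_notMem (s := insertArc) (by decide) υ
    · rw [← a2]; exact arr_run_of_notMem (s := insertArc) (by decide) υ
    · rw [State.reg_setReg_of_ne _ (by decide), reg_run_of_notMem (by decide), a3]
    · rw [State.reg_setReg_of_ne _ (by decide), reg_run_of_notMem (by decide), a4]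
    · rw [State.arr_setReg, b1, hk]
      by_cases h : e = k
      · subst h; simp [hk0]
      · rw [Function.update_of_ne h, a5]
        have : e < k + 1 ↔ e < k := by omega
        simp only [this]

/-! ### Reading the input -/

theorem divNat_mk {m n : ℕ} (i : Fin m) (j : Fin n) (h : (i : ℕ) * n + j < m * n) :
    (⟨i * n + j, h⟩ : Fin (m * n)).divNat = i := by
  ext
  have hn : 0 < n := j.pos
  simp only [Fin.divNat]
  rw [Nat.add_comm, Nat.add_mul_div_right _ _ hn, Nat.div_eq_of_lt j.isLt, Nat.zero_add]

theorem modNat_mk {m n : ℕ} (i : Fin m) (j : Fin n) (h : (i : ℕ) * n + j < m * n) :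
    (⟨i * n + j, h⟩ : Fin (m * n)).modNat = j := by
  ext
  simp [Fin.modNat, Nat.add_mod, Nat.mod_eq_of_lt j.isLt]

theorem listMat_eq_ofFn {m n : ℕ} (A : Fin m → Fin n → ℤ) :
    listMat A = List.ofFn fun k : Fin (m * n) => A k.divNat k.modNat := by
  rw [List.ofFn_mul, listMat, List.flatMap, ← List.ofFn_eq_map]
  simp only [listVec, divNat_mk, modNat_mk]

@[simp] theorem length_listMat {m n : ℕ} (A : Fin m → Fin n → ℤ) :
    (listMat A).length = m * n := by simp [listMat_eq_ofFn]

@[simp] theorem length_listVec {n : ℕ} (v : Fin n → ℤ) : (listVec v).length = n := by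
  simp [listVec]

theorem getD_append_append (A B C : List ℤ) {i : ℕ} (h : i < B.length) :
    (A ++ B ++ C).getD (A.length + i) 0 = B.getD i 0 := by
  rw [List.append_assoc, List.getD_append_right _ _ _ _ (by omega), Nat.add_sub_cancel_left,
    List.getD_append _ _ _ _ h]

theorem getD_listVec {n : ℕ} (v : Fin n → ℤ) (i : Fin n) : (listVec v).getD i 0 = v i := by
  simp [listVec]

theorem lt_mul_of_fin {m n : ℕ} (i : Fin m) (j : Fin n) : (i : ℕ) * n + j < m * n := by
  calc (i : ℕ) * n + j < i * n + n := by have := j.isLt; omega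
    _ = (i + 1) * n := by ring
    _ ≤ m * n := Nat.mul_le_mul_right n i.isLt

theorem getD_listMat {m n : ℕ} (A : Fin m → Fin n → ℤ) (i : Fin m) (j : Fin n) :
    (listMat A).getD (i * n + j) 0 = A i j := by
  have h := lt_mul_of_fin i j
  rw [listMat_eq_ofFn, List.getD_eq_getElem _ _ (by simpa using h), List.getElem_ofFn]
  rw [divNat_mk, modNat_mk]

/-- Division by 16 with remainder finds the array of a cell, so the frame property of the arrays
covers the whole memory. -/
theorem State.mem_eq_arr (σ : State) (a : ℤ) :
    σ.mem a = σ.arr (Fin.ofNat 16 (a % 16).toNat) (a / 16) := by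
  simp only [State.arr, Fin.ofNat]
  congr 1
  omega

theorem mem_run_of_stores_eq_nil {s : Stmt} (h : s.stores = []) (σ : State) :
    (s.run σ).mem = σ.mem := by
  funext a
  rw [State.mem_eq_arr, State.mem_eq_arr, arr_run_of_notMem (by simp [h])]

/-- The cell `e` of the input. -/
def inp (e : Expr) : Expr := .arr 0 (.sub (.const (-1)) e)

/-- Filling the array `j`, with as many entries as the register `n` says, by the multiples of the
register `st`, beginning with the content of the register 14. -/
def rows (j : Fin 16) (n st : ℕ) : Stmt := upto 10 n
  (block [aset j (.reg 10) (.reg 14), assign 14 (.add (.reg 14) (.reg st))])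

theorem rows_spec (j : Fin 16) (n st : ℕ) (hst : st ≠ 14) (hst' : st ≠ 10) {σ : State} {c : ℤ}
    (hn : σ.reg n = c) (hc : 0 ≤ c) :
    (∀ i, 0 ≤ i → i < c → ((rows j n st).run σ).arr j i = σ.reg 14 + i * σ.reg st) ∧
      ((rows j n st).run σ).reg 14 = σ.reg 14 + c * σ.reg st := by
  have key := run_upto_induction (i := 10) (n := n) (σ := σ) (c := c)
    (p := block [aset j (.reg 10) (.reg 14), assign 14 (.add (.reg 14) (.reg st))])
    (fun k τ => τ.reg st = σ.reg st ∧ τ.reg 14 = σ.reg 14 + k * σ.reg st ∧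
      ∀ i, 0 ≤ i → i < k → τ.arr j i = σ.reg 14 + i * σ.reg st) hn hc ?_ ?_
  · exact ⟨key.2.2, key.2.1⟩
  · refine ⟨by simp [hst'], by simp, fun i h1 h2 => by omega⟩
  · rintro k τ hk0 hkc hk ⟨h1, h2, h3⟩
    refine ⟨by simp [block, run, hst, hst', h1], ?_, fun i hi0 hi => ?_⟩
    · simp [block, run, h1, h2]; ring
    · by_cases h : i = k
      · simp [block, run, hk, h, h2]
      · simpa [block, run, hk, h] using h3 i hi0 (by omega)

/-- Loading the dimensions of the instance. -/
def load : Stmt := block [assign 0 (.mem (.const 0)), assign 1 (.mem (.const 1)),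
  assign 2 (.mem (.const 2)), assign 3 (.add (.add (.reg 0) (.reg 1)) (.reg 2)),
  assign 4 (.add (.add (.add (.reg 3) (.reg 3)) (.reg 3)) (.const 3))]

/-- Computing a bound for the length of the input. -/
def count : Stmt := upto 10 3 (upto 11 3 (assign 4 (.add (.reg 4) (.const 2))))

/-- Copying the input to the negative indices of the array 0. -/
def copyInput : Stmt := upto 10 4
  -- Negative indices only reach negative cells. The input is therefore intact while it is copied,
  -- and afterwards the nonnegative cells are free for the other arrays.
  (store (.add (Expr.sub (.const (-1)) (.reg 10)).dbl.dbl.dbl.dbl (.const 0)) (.mem (.reg 10)))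

/-- Computing the addresses of the data and the rows of the matrices. -/
def layout : Stmt := block [assign 14 (.const 3), rows 9 1 2, assign 5 (.reg 14), rows 10 1 2,
  rows 11 0 1, assign 6 (.reg 14), assign 7 (.add (.reg 6) (.reg 0)),
  assign 8 (.add (.reg 7) (.reg 0)), assign 14 (.add (.reg 8) (.reg 0)), rows 12 2 0,
  rows 13 0 0, assign 9 (.add (.add (.reg 5) (.reg 0)) (.reg 0)), assign 16 (.const 0)]

/-- The machine cannot multiply, so the square comes from two nested loops. Only an upper bound for
the input length is needed, since copying too many cells does no harm. -/
theorem count_spec {σ : State} {T : ℤ} (hT : σ.reg 3 = T) (hT0 : 0 ≤ T) :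
    (count.run σ).reg 4 = σ.reg 4 + 2 * T * T := by
  have key := run_upto_induction (i := 10) (n := 3) (σ := σ) (c := T)
    (p := upto 11 3 (assign 4 (.add (.reg 4) (.const 2))))
    (fun k τ => τ.reg 3 = T ∧ τ.reg 4 = σ.reg 4 + 2 * T * k) hT hT0 (by simp [hT]) ?_
  · exact key.2
  · rintro k τ - - - ⟨h3, h4⟩
    have key := run_upto_induction (i := 11) (n := 3) (σ := τ) (c := T)
      (p := assign 4 (.add (.reg 4) (.const 2)))
      (fun k τ' => τ'.reg 3 = T ∧ τ'.reg 4 = τ.reg 4 + 2 * k) h3 hT0 (by simp [h3]) ?_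
    · rw [State.reg_setReg_of_ne _ (by decide), State.reg_setReg_of_ne _ (by decide)]
      refine ⟨key.1, ?_⟩
      rw [key.2, h4]; ring
    · rintro k' τ' - - - ⟨h3', h4'⟩
      refine ⟨by simp [run, h3'], ?_⟩
      simp [run, h4']; ring

theorem copyInput_spec {σ : State} {c : ℤ} (hc : σ.reg 4 = c) (hc0 : 0 ≤ c) {k : ℤ} (hk : 0 ≤ k)
    (hkc : k < c) : (copyInput.run σ).arr 0 (-1 - k) = σ.mem k := by
  have key := run_upto_induction (i := 10) (n := 4) (σ := σ) (c := c)
    (p := store (.add (Expr.sub (.const (-1)) (.reg 10)).dbl.dbl.dbl.dbl (.const 0))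
      (.mem (.reg 10)))
    (fun k τ => (∀ i, 0 ≤ i → τ.mem i = σ.mem i) ∧
      ∀ i, 0 ≤ i → i < k → τ.arr 0 (-1 - i) = σ.mem i) hc hc0 ?_ ?_
  · exact key.2 k hk hkc
  · exact ⟨fun i _ => rfl, fun i h1 h2 => by omega⟩
  · rintro k τ hk0 - hk ⟨h1, h2⟩
    have e1 : (store (.add (Expr.sub (.const (-1)) (.reg 10)).dbl.dbl.dbl.dbl (.const 0))
        (.mem (.reg 10))).run τ = τ.setArr 0 (-1 - k) (τ.mem k) := by
      simp only [run, Expr.dbl, Expr.val, hk, State.setArr]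
      congr 1
      simp
      ring
    rw [e1]
    refine ⟨fun i hi => ?_, fun i hi0 hi => ?_⟩
    · rw [State.mem_setReg, ← h1 i hi]
      have : i ≠ 16 * (-1 - k) := by omega
      simp [State.setArr, State.setMem, this]
    · by_cases h : i = k
      · simp [h, h1 k hk0]
      · simpa [h] using h2 i hi0 (by omega)

/-- A bound for the length of the input. -/
def Instance.cnt (I : Instance) : ℤ :=
  3 * (I.nD + I.nR + I.nS : ℤ) + 3 + 2 * (I.nD + I.nR + I.nS : ℤ) * (I.nD + I.nR + I.nS : ℤ)

/-- The registers and arrays hold the data of the instance. -/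
structure State.Inputs (σ : State) (I : Instance) : Prop where
  nD : σ.reg 0 = I.nD
  nR : σ.reg 1 = I.nR
  nS : σ.reg 2 = I.nS
  cnt : σ.reg 4 = I.cnt
  -- Addresses double as node numbers. The addresses of the first matrix number the supply nodes,
  -- and the address where the second matrix begins is the first `inNode`. This is why numbering
  -- resumes at 3 after the depot 0; the nodes 1 and 2 are isolated.
  base : σ.reg 5 = 3 + I.nR * I.nS
  nodes : σ.reg 9 = 3 + I.nR * I.nS + 2 * I.nD
  row : ∀ r : Fin I.nR, σ.arr 9 (r : ℕ) = 3 + (r : ℕ) * I.nS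
  S : ∀ (r : Fin I.nR) (s : Fin I.nS),
    σ.arr 0 (-1 - (σ.arr 9 (r : ℕ) + (s : ℕ))) = if s ∈ I.S r then 1 else 0
  l : ∀ (r : Fin I.nR) (s : Fin I.nS),
    σ.arr 0 (-1 - (σ.arr 10 (r : ℕ) + (s : ℕ))) = if s ∈ I.S r then (I.l r s : ℤ) else 0
  M : ∀ (d : Fin I.nD) (r : Fin I.nR),
    σ.arr 0 (-1 - (σ.arr 11 (d : ℕ) + (r : ℕ))) = if r ∈ I.M d then 1 else 0
  τ : ∀ d : Fin I.nD, σ.arr 0 (-1 - (σ.reg 6 + (d : ℕ))) = I.τ d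
  Δ : ∀ d : Fin I.nD, σ.arr 0 (-1 - (σ.reg 7 + (d : ℕ))) = I.Δ d
  w : ∀ d : Fin I.nD, σ.arr 0 (-1 - (σ.reg 8 + (d : ℕ))) = I.w d
  fS : ∀ (s : Fin I.nS) (d : Fin I.nD),
    σ.arr 0 (-1 - (σ.arr 12 (s : ℕ) + (d : ℕ))) = I.fS s d
  fD : ∀ i j : Fin I.nD, σ.arr 0 (-1 - (σ.arr 13 (i : ℕ) + (j : ℕ))) = I.fD i j

/-- Reading the input. -/
def readInput : Stmt := block [load, count, copyInput, layout]

theorem reg_rows (j : Fin 16) (n st : ℕ) (σ : State) {x : ℕ} (h : x ≠ 10) (h' : x ≠ 14) :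
    ((rows j n st).run σ).reg x = σ.reg x :=
  reg_run_of_notMem (by simp [rows, block, writes, h, h']) σ

theorem arr_rows (j : Fin 16) (n st : ℕ) (σ : State) {j' : Fin 16} (h : j' ≠ j) :
    ((rows j n st).run σ).arr j' = σ.arr j' :=
  arr_run_of_notMem (by simp [rows, block, stores, h]) σ

theorem read_block {σ : State} {L : List ℤ}
    (ha : ∀ k : ℕ, k < L.length → σ.arr 0 (-1 - (k : ℤ)) = L.getD k 0) {A B : List ℤ}
    (hL : A ++ B <+: L) {i : ℕ} (hi : i < B.length) {k : ℤ} (hk : k = A.length + i) :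
    σ.arr 0 (-1 - k) = B.getD i 0 := by
  obtain ⟨C, rfl⟩ := hL
  have hk' : k = (A.length + i : ℕ) := by rw [hk]; push_cast; ring
  rw [hk', ha _ (by simp only [List.length_append]; omega), getD_append_append _ _ _ hi]

/-- The lengths of the prefixes are the addresses at which the blocks of the input begin; `layout`
reaches the same values by repeated addition. -/
theorem Instance.prefixes_encode (I : Instance) :
    ∃ A₁ A₂ A₃ A₄ A₅ A₆ A₇ A₈ : List ℤ,
      (A₁ ++ listMat (fun r s => if s ∈ I.S r then 1 else 0) <+: I.encode ∧
        (A₁.length : ℤ) = 3) ∧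
      (A₂ ++ listMat (fun r s => if s ∈ I.S r then (I.l r s : ℤ) else 0) <+: I.encode ∧
        (A₂.length : ℤ) = 3 + I.nR * I.nS) ∧
      (A₃ ++ listMat (fun d r => if r ∈ I.M d then 1 else 0) <+: I.encode ∧
        (A₃.length : ℤ) = 3 + I.nR * I.nS + I.nR * I.nS) ∧
      (A₄ ++ listVec I.τ <+: I.encode ∧
        (A₄.length : ℤ) = 3 + I.nR * I.nS + I.nR * I.nS + I.nD * I.nR) ∧
      (A₅ ++ listVec I.Δ <+: I.encode ∧
        (A₅.length : ℤ) = 3 + I.nR * I.nS + I.nR * I.nS + I.nD * I.nR + I.nD) ∧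
      (A₆ ++ listVec I.w <+: I.encode ∧
        (A₆.length : ℤ) = 3 + I.nR * I.nS + I.nR * I.nS + I.nD * I.nR + I.nD + I.nD) ∧
      (A₇ ++ listMat I.fS <+: I.encode ∧
        (A₇.length : ℤ) = 3 + I.nR * I.nS + I.nR * I.nS + I.nD * I.nR + I.nD + I.nD + I.nD) ∧
      (A₈ ++ listMat I.fD <+: I.encode ∧
        (A₈.length : ℤ) = 3 + I.nR * I.nS + I.nR * I.nS + I.nD * I.nR + I.nD + I.nD + I.nD +
          I.nS * I.nD) := by
  have step : ∀ {A B C : List ℤ}, A <+: B → A <+: B ++ C := fun h =>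
    h.trans (List.prefix_append _ _)
  unfold Instance.encode
  exact ⟨_, _, _, _, _, _, _, _,
    ⟨step (step (step (step (step (step (step List.prefix_rfl)))))), by simp⟩,
    ⟨step (step (step (step (step (step List.prefix_rfl))))), by simp; ring⟩,
    ⟨step (step (step (step (step List.prefix_rfl)))), by simp; ring⟩,
    ⟨step (step (step (step List.prefix_rfl))), by simp; ring⟩,
    ⟨step (step (step List.prefix_rfl)), by simp; ring⟩,
    ⟨step (step List.prefix_rfl), by simp; ring⟩,
    ⟨step List.prefix_rfl, by simp; ring⟩,
    ⟨List.prefix_rfl, by simp; ring⟩⟩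

theorem layout_spec {I : Instance} {σ : State} (h0 : σ.reg 0 = I.nD) (h1 : σ.reg 1 = I.nR)
    (h2 : σ.reg 2 = I.nS) (h4 : σ.reg 4 = I.cnt)
    (ha : ∀ k : ℕ, k < I.encode.length → σ.arr 0 (-1 - (k : ℤ)) = I.encode.getD k 0) :
    (layout.run σ).Inputs I ∧ (layout.run σ).reg 16 = 0 := by
  have spec : ∀ (j : Fin 16) (n st : ℕ) (c : ℕ), st ≠ 14 → st ≠ 10 → ∀ τ : State, τ.reg n = c →
      (∀ i : Fin c, ((rows j n st).run τ).arr j (i : ℕ) = τ.reg 14 + (i : ℕ) * τ.reg st) ∧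
      ((rows j n st).run τ).reg 14 = τ.reg 14 + c * τ.reg st := by
    intro j n st c h h' τ hn
    obtain ⟨a, b⟩ := rows_spec j n st h h' hn (by omega)
    exact ⟨fun i => a _ (by omega) (by have := i.isLt; omega), b⟩
  obtain ⟨s₁, hs₁⟩ : ∃ s, s = (rows 9 1 2).run (σ.setReg 14 3) := ⟨_, rfl⟩
  obtain ⟨s₂, hs₂⟩ : ∃ s, s = (rows 10 1 2).run (s₁.setReg 5 (s₁.reg 14)) := ⟨_, rfl⟩
  obtain ⟨s₃, hs₃⟩ : ∃ s, s = (rows 11 0 1).run s₂ := ⟨_, rfl⟩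
  obtain ⟨s₄, hs₄⟩ : ∃ s, s = ((((s₃.setReg 6 (s₃.reg 14)).setReg 7 (s₃.reg 14 + s₃.reg 0)).setReg 8
    (s₃.reg 14 + s₃.reg 0 + s₃.reg 0)).setReg 14 (s₃.reg 14 + s₃.reg 0 + s₃.reg 0 + s₃.reg 0)) :=
      ⟨_, rfl⟩
  obtain ⟨s₅, hs₅⟩ : ∃ s, s = (rows 12 2 0).run s₄ := ⟨_, rfl⟩
  obtain ⟨s₆, hs₆⟩ : ∃ s, s = (rows 13 0 0).run s₅ := ⟨_, rfl⟩
  have e : layout.run σ = (s₆.setReg 9 (s₆.reg 5 + s₆.reg 0 + s₆.reg 0)).setReg 16 0 := by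
    simp [layout, block, Stmt.run.eq_5, Stmt.run.eq_2, hs₁, hs₂, hs₃, hs₄, hs₅, hs₆]
  have f₁ : ∀ x, x ≠ 10 → x ≠ 14 → s₁.reg x = σ.reg x := fun x hx hx' => by
    rw [hs₁, reg_rows _ _ _ _ hx hx', State.reg_setReg_of_ne _ hx']
  have f₂ : ∀ x, x ≠ 10 → x ≠ 14 → x ≠ 5 → s₂.reg x = σ.reg x := fun x hx hx' h5 => by
    rw [hs₂, reg_rows _ _ _ _ hx hx', State.reg_setReg_of_ne _ h5, f₁ x hx hx']
  have f₃ : ∀ x, x ≠ 10 → x ≠ 14 → s₃.reg x = s₂.reg x := fun x hx hx' => by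
    rw [hs₃, reg_rows _ _ _ _ hx hx']
  have f₅ : ∀ x, x ≠ 10 → x ≠ 14 → s₅.reg x = s₄.reg x := fun x hx hx' => by
    rw [hs₅, reg_rows _ _ _ _ hx hx']
  have f₆ : ∀ x, x ≠ 10 → x ≠ 14 → s₆.reg x = s₅.reg x := fun x hx hx' => by
    rw [hs₆, reg_rows _ _ _ _ hx hx']
  obtain ⟨a₁, p₁⟩ := spec 9 1 2 I.nR (by decide) (by decide) (σ.setReg 14 3) (by simpa using h1)
  rw [← hs₁] at a₁ p₁
  simp only [State.reg_setReg_self, State.reg_setReg_of_ne, ne_eq, Nat.reduceEqDiff,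
    not_false_eq_true, h2] at a₁ p₁
  obtain ⟨a₂, p₂⟩ := spec 10 1 2 I.nR (by decide) (by decide) (s₁.setReg 5 (s₁.reg 14))
    (by simpa [f₁] using h1)
  rw [← hs₂] at a₂ p₂
  simp only [State.reg_setReg_of_ne, ne_eq, Nat.reduceEqDiff, not_false_eq_true, p₁,
    f₁ 2 (by decide) (by decide), h2] at a₂ p₂
  obtain ⟨a₃, p₃⟩ := spec 11 0 1 I.nD (by decide) (by decide) s₂ (by simpa [f₂] using h0)
  rw [← hs₃] at a₃ p₃
  simp only [p₂, f₂ 1 (by decide) (by decide) (by decide), h1] at a₃ p₃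
  have r0 : s₃.reg 0 = I.nD := by simp [f₃, f₂, h0]
  have r2 : s₃.reg 2 = I.nS := by simp [f₃, f₂, h2]
  have q0 : s₄.reg 0 = I.nD := by simp [hs₄, r0]
  have q2 : s₄.reg 2 = I.nS := by simp [hs₄, r2]
  have q14 : s₄.reg 14 = s₃.reg 14 + I.nD + I.nD + I.nD := by simp [hs₄, r0]
  obtain ⟨a₅, p₅⟩ := spec 12 2 0 I.nS (by decide) (by decide) s₄ q2
  rw [← hs₅] at a₅ p₅
  rw [q14, q0] at p₅
  simp only [q14, q0] at a₅
  obtain ⟨a₆, p₆⟩ := spec 13 0 0 I.nD (by decide) (by decide) s₅ (by rw [f₅ 0 (by decide) (by decide), q0])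
  rw [← hs₆] at a₆ p₆
  simp only [p₅, f₅ 0 (by decide) (by decide), q0] at a₆
  have b₂ : ∀ j, j ≠ 9 → j ≠ 10 → s₂.arr j = σ.arr j := fun j h9 h10 => by
    rw [hs₂, arr_rows _ _ _ _ h10, State.arr_setReg, hs₁, arr_rows _ _ _ _ h9, State.arr_setReg]
  have b₃ : ∀ j, j ≠ 11 → s₃.arr j = s₂.arr j := fun j h => by rw [hs₃, arr_rows _ _ _ _ h]
  have b₆ : ∀ j, j ≠ 12 → j ≠ 13 → s₆.arr j = s₃.arr j := fun j h12 h13 => by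
    rw [hs₆, arr_rows _ _ _ _ h13, hs₅, arr_rows _ _ _ _ h12, hs₄]; rfl
  have c0 : s₆.arr 0 = σ.arr 0 := by
    rw [b₆ _ (by decide) (by decide), b₃ _ (by decide), b₂ _ (by decide) (by decide)]
  have c9 : s₆.arr 9 = s₁.arr 9 := by
    rw [b₆ _ (by decide) (by decide), b₃ _ (by decide), hs₂, arr_rows _ _ _ _ (by decide)]; rfl
  have c10 : s₆.arr 10 = s₂.arr 10 := by
    rw [b₆ _ (by decide) (by decide), b₃ _ (by decide)]
  have c11 : s₆.arr 11 = s₃.arr 11 := b₆ _ (by decide) (by decide)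
  have c12 : s₆.arr 12 = s₅.arr 12 := by rw [hs₆, arr_rows _ _ _ _ (by decide)]
  have r5 : s₂.reg 5 = 3 + I.nR * I.nS := by
    rw [hs₂, reg_rows _ _ _ _ (by decide) (by decide), State.reg_setReg_self, p₁]
  rw [e]
  obtain ⟨A₁, A₂, A₃, A₄, A₅, A₆, A₇, A₈, ⟨t₁, n₁⟩, ⟨t₂, n₂⟩, ⟨t₃, n₃⟩, ⟨t₄, n₄⟩, ⟨t₅, n₅⟩,
    ⟨t₆, n₆⟩, ⟨t₇, n₇⟩, ⟨t₈, n₈⟩⟩ := I.prefixes_encode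
  have u6 : s₆.reg 6 = s₃.reg 14 := by simp [f₆, f₅, hs₄]
  have u7 : s₆.reg 7 = s₃.reg 14 + I.nD := by simp [f₆, f₅, hs₄, r0]
  have u8 : s₆.reg 8 = s₃.reg 14 + I.nD + I.nD := by simp [f₆, f₅, hs₄, r0]
  refine ⟨⟨?_, ?_, ?_, ?_, ?_, ?_, fun r => ?_, fun r s => ?_, fun r s => ?_, fun d r => ?_, fun d => ?_,
    fun d => ?_, fun d => ?_, fun s d => ?_, fun i j => ?_⟩, by simp⟩
  · simp [f₆, f₅, q0]
  · simp [f₆, f₅, hs₄, f₃, f₂, h1]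
  · simp [f₆, f₅, q2]
  · simp [f₆, f₅, hs₄, f₃, f₂, h4]
  · simp [f₆, f₅, hs₄, f₃, r5]
  · simp [f₆, f₅, hs₄, f₃, r5, f₂, h0]; ring
  · simp [c9, a₁]
  · simp only [State.arr_setReg, c0, c9, a₁]
    rw [read_block ha t₁ (i := r * I.nS + s)
      (by simpa using lt_mul_of_fin r s) (by rw [n₁]; push_cast; ring), getD_listMat]
  · simp only [State.arr_setReg, c0, c10, a₂]
    rw [read_block ha t₂ (i := r * I.nS + s)
      (by simpa using lt_mul_of_fin r s) (by rw [n₂]; push_cast; ring), getD_listMat]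
  · simp only [State.arr_setReg, c0, c11, a₃]
    rw [read_block ha t₃ (i := d * I.nR + r)
      (by simpa using lt_mul_of_fin d r) (by rw [n₃]; push_cast; ring), getD_listMat]
  · simp only [State.arr_setReg, c0, State.reg_setReg_of_ne, ne_eq, Nat.reduceEqDiff,
      not_false_eq_true, u6, p₃]
    rw [read_block ha t₄ (i := d) (by simp) (by rw [n₄]), getD_listVec]
  · simp only [State.arr_setReg, c0, State.reg_setReg_of_ne, ne_eq, Nat.reduceEqDiff,
      not_false_eq_true, u7, p₃]
    rw [read_block ha t₅ (i := d) (by simp) (by rw [n₅]), getD_listVec]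
  · simp only [State.arr_setReg, c0, State.reg_setReg_of_ne, ne_eq, Nat.reduceEqDiff,
      not_false_eq_true, u8, p₃]
    rw [read_block ha t₆ (i := d) (by simp) (by rw [n₆]), getD_listVec]
  · simp only [State.arr_setReg, c0, c12, a₅, p₃]
    rw [read_block ha t₇ (i := s * I.nD + d)
      (by simpa using lt_mul_of_fin s d) (by rw [n₇]; push_cast; ring), getD_listMat]
  · simp only [State.arr_setReg, c0, a₆, p₃]
    rw [read_block ha t₈ (i := i * I.nD + j)
      (by simpa using lt_mul_of_fin i j) (by rw [n₈]; push_cast; ring), getD_listMat]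

theorem Instance.length_encode (I : Instance) : I.encode.length = 3 + I.nR * I.nS + I.nR * I.nS +
    I.nD * I.nR + I.nD + I.nD + I.nD + I.nS * I.nD + I.nD * I.nD := by
  simp [Instance.encode]
  ring

theorem load_spec (I : Instance) : (load.run (State.init I.encode)).reg 0 = I.nD ∧
    (load.run (State.init I.encode)).reg 1 = I.nR ∧
    (load.run (State.init I.encode)).reg 2 = I.nS ∧
    (load.run (State.init I.encode)).reg 3 = I.nD + I.nR + I.nS ∧
    (load.run (State.init I.encode)).reg 4 = 3 * (I.nD + I.nR + I.nS) + 3 := by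
  have m0 : (State.init I.encode).mem 0 = I.nD := by simp [State.init, Instance.encode]
  have m1 : (State.init I.encode).mem 1 = I.nR := by simp [State.init, Instance.encode]
  have m2 : (State.init I.encode).mem 2 = I.nS := by simp [State.init, Instance.encode]
  refine ⟨?_, ?_, ?_, ?_, ?_⟩ <;> simp [load, block, run, m0, m1, m2]
  ring

theorem count_load_spec (I : Instance) :
    (count.run (load.run (State.init I.encode))).reg 4 = I.cnt := by
  obtain ⟨-, -, -, l3, l4⟩ := load_spec I
  rw [count_spec l3 (by positivity), l4, Instance.cnt]

theorem readInput_spec (I : Instance) :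
    (readInput.run (State.init I.encode)).Inputs I ∧
      (readInput.run (State.init I.encode)).reg 16 = 0 := by
  obtain ⟨l0, l1, l2, l3, l4⟩ := load_spec I
  have hcnt := count_load_spec I
  have lm : (load.run (State.init I.encode)).mem = (State.init I.encode).mem := rfl
  have e : readInput.run (State.init I.encode) =
    layout.run (copyInput.run (count.run (load.run (State.init I.encode)))) := rfl
  rw [e]
  generalize load.run (State.init I.encode) = s₁ at *
  have nm : (count.run s₁).mem = s₁.mem := mem_run_of_stores_eq_nil rfl s₁
  have n : ∀ x, x ≠ 4 → x ≠ 10 → x ≠ 11 → (count.run s₁).reg x = s₁.reg x := fun x h4 h10 h11 =>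
    reg_run_of_notMem (by simp [count, writes, h4, h10, h11]) s₁
  generalize count.run s₁ = s₂ at *
  have o : ∀ x, x ≠ 10 → (copyInput.run s₂).reg x = s₂.reg x := fun x h10 =>
    reg_run_of_notMem (by simp [copyInput, writes, h10]) s₂
  -- Each product of two dimensions in the length is covered by twice the square of their sum.
  have hlen : (I.encode.length : ℤ) ≤ I.cnt := by
    rw [I.length_encode, Instance.cnt]
    push_cast
    have h1 : (0 : ℤ) ≤ I.nD := by omega
    have h2 : (0 : ℤ) ≤ I.nR := by omega
    have h3 : (0 : ℤ) ≤ I.nS := by omega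
    nlinarith [mul_nonneg h1 h2, mul_nonneg h2 h3, mul_nonneg h1 h3, mul_nonneg h1 h1,
      mul_nonneg h2 h2, mul_nonneg h3 h3]
  refine layout_spec ?_ ?_ ?_ ?_ fun k hk => ?_
  · rw [o 0 (by decide), n 0 (by decide) (by decide) (by decide), l0]
  · rw [o 1 (by decide), n 1 (by decide) (by decide) (by decide), l1]
  · rw [o 2 (by decide), n 2 (by decide) (by decide) (by decide), l2]
  · rw [o 4 (by decide), hcnt]
  · rw [copyInput_spec hcnt (by omega) (by omega) (by omega), nm, lm]
    simp [State.init]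

/-! ### The network of an instance -/

/-- The arcs of the network: one for each variable of the integer program, one for the supply of each
resource type at each starting location, and one for each demand that lets additional resources
pass. -/
inductive Arc (I : Instance)
  | y (d : Fin I.nD)
  | start (r : Fin I.nR) (s : Fin I.nS) (d : Fin I.nD)
  | move (r : Fin I.nR) (i j : Fin I.nD)
  | last (r : Fin I.nR) (d : Fin I.nD)
  | supply (r : Fin I.nR) (s : Fin I.nS)
  | pass (d : Fin I.nD)

namespace Instance

variable (I : Instance)

/-- The node at which the resources of type `r` start from `s`; the node `0` is the depot. -/
def supplyNode (r : Fin I.nR) (s : Fin I.nS) : ℤ := 3 + (r : ℕ) * I.nS + (s : ℕ)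

/-- The node at which the resources arrive that serve the demand `d`. -/
def inNode (d : Fin I.nD) : ℤ := 3 + I.nR * I.nS + (d : ℕ)

/-- The node from which the resources leave that have served the demand `d`. -/
def outNode (d : Fin I.nD) : ℤ := 3 + I.nR * I.nS + I.nD + (d : ℕ)

end Instance

namespace Arc

variable {I : Instance}

/-- The tail of an arc. -/
def tail : Arc I → ℤ
  | y d => I.inNode d
  | start r s _ => I.supplyNode r s
  | move _ i _ => I.outNode i
  | last _ d => I.outNode d
  | supply _ _ => 0
  | pass d => I.inNode d

/-- The head of an arc. -/
def head : Arc I → ℤ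
  | y d => I.outNode d
  | start _ _ d => I.inNode d
  | move _ _ j => I.inNode j
  | last _ _ => 0
  | supply r s => I.supplyNode r s
  | pass d => I.outNode d

/-- The reward of an arc. -/
def reward : Arc I → ℤ
  | y d => I.w d
  | _ => 0

open Classical in
/-- The capacity of an arc before the insertion of the arcs of positive reward. -/
noncomputable def cap : Arc I → ℤ
  | y _ => 0
  | start r s d => if I.B r s d then 1 else 0
  | move r i j => if I.A i j ∧ r ∈ I.M i ∩ I.M j then 1 else 0
  | last r d => if r ∈ I.M d then 1 else 0
  | supply r s => if s ∈ I.S r then I.l r s else 0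
  | pass _ => I.cnt

/-- The arcs `y d`. -/
def yList (I : Instance) : List (Arc I) := (List.finRange I.nD).flatMap fun d => [y d]

/-- The other arcs. -/
def restList (I : Instance) : List (Arc I) :=
  ((List.finRange I.nR).flatMap fun r => (List.finRange I.nS).flatMap fun s =>
      (List.finRange I.nD).flatMap fun d => [start r s d]) ++
  ((List.finRange I.nR).flatMap fun r => (List.finRange I.nD).flatMap fun i =>
      (List.finRange I.nD).flatMap fun j => [move r i j]) ++
  ((List.finRange I.nR).flatMap fun r => (List.finRange I.nD).flatMap fun d => [last r d]) ++
  ((List.finRange I.nR).flatMap fun r => (List.finRange I.nS).flatMap fun s => [supply r s]) ++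
  ((List.finRange I.nD).flatMap fun d => [pass d])

/-- All arcs, those of the variables in the order of the output. -/
def list (I : Instance) : List (Arc I) := yList I ++ restList I

end Arc

/-! ### Building the network, with rules for the arcs that a statement appends -/

/-- The arrays hold the arcs of the list `L`, in this order. -/
structure State.Holds {I : Instance} (σ : State) (L : List (Arc I)) : Prop where
  length : σ.reg 16 = L.length
  arc : ∀ (k : ℕ) (h : k < L.length), σ.arr 1 k = L[k].tail ∧ σ.arr 2 k = L[k].head ∧
    σ.arr 3 k = L[k].cap ∧ σ.arr 4 k = L[k].reward ∧ σ.arr 5 k = 0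

theorem State.Holds.setReg {I : Instance} {σ : State} {L : List (Arc I)} (h : σ.Holds L) {x : ℕ}
    (hx : 16 ≠ x) (v : ℤ) : (σ.setReg x v).Holds L :=
  ⟨by rw [State.reg_setReg_of_ne _ hx, h.length], h.arc⟩

/-- Appending an arc to the network. -/
def emit : Stmt := block [aset 1 (.reg 16) (.reg 20), aset 2 (.reg 16) (.reg 21),
  aset 3 (.reg 16) (.reg 15), aset 4 (.reg 16) (.reg 22), aset 5 (.reg 16) (.const 0),
  assign 16 (.add (.reg 16) (.const 1))]

theorem emit_spec {I : Instance} {σ : State} {L : List (Arc I)} (h : σ.Holds L) (a : Arc I)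
    (h1 : σ.reg 20 = a.tail) (h2 : σ.reg 21 = a.head) (h3 : σ.reg 15 = a.cap)
    (h4 : σ.reg 22 = a.reward) : (emit.run σ).Holds (L ++ [a]) := by
  refine ⟨by simp [emit, block, run, h.length], fun k hk => ?_⟩
  have hl := h.length
  by_cases hkl : k = L.length
  · subst hkl
    simp [emit, block, run, hl, h1, h2, h3, h4]
  · rw [List.length_append, List.length_singleton] at hk
    have hk' : k < L.length := by omega
    have hne : (k : ℤ) ≠ L.length := by omega
    have := h.arc k hk'
    simpa [emit, block, run, hl, hkl, List.getElem_append_left hk'] using this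

/-- Setting register 15 to `1` or `0`, according as the conditions hold or not. -/
def test (l : List Expr) : Stmt := seq (assign 15 (.const 0)) (whens l (assign 15 (.const 1)))

theorem reg_run_test (l : List Expr) (σ : State) : ((test l).run σ).reg 15 =
    if ∀ e ∈ l, 0 < e.val (σ.setReg 15 0) then 1 else 0 := by
  simp only [test, run, run_whens, Expr.val_const]
  split_ifs <;> simp

theorem reg_run_test_of_ne (l : List Expr) (σ : State) {x : ℕ} (hx : x ≠ 15) :
    ((test l).run σ).reg x = σ.reg x := by
  simp only [test, run, run_whens]
  split_ifs <;> simp [hx]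

/-- In a state with the data of the instance and with the given contents of registers, the statement
`s` appends the arcs of the list `L`. -/
def Emits (I : Instance) (ρ : List (ℕ × ℤ)) (s : Stmt) (L : List (Arc I)) : Prop :=
  ∀ (σ : State) (K : List (Arc I)), σ.Inputs I → (∀ q ∈ ρ, σ.reg q.1 = q.2) → σ.Holds K →
    (s.run σ).Holds (K ++ L)

theorem State.Inputs.congr {I : Instance} {σ σ' : State} (h : σ.Inputs I)
    (hr : ∀ x < 10, σ'.reg x = σ.reg x)
    (ha : ∀ j ∉ ([1, 2, 3, 4, 5] : List (Fin 16)), σ'.arr j = σ.arr j) : σ'.Inputs I := by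
  have r0 := hr 0 (by decide)
  have r1 := hr 1 (by decide)
  have r2 := hr 2 (by decide)
  have r4 := hr 4 (by decide)
  have r5 := hr 5 (by decide)
  have r6 := hr 6 (by decide)
  have r7 := hr 7 (by decide)
  have r8 := hr 8 (by decide)
  have r9 := hr 9 (by decide)
  have a0 := ha 0 (by decide)
  have a9 := ha 9 (by decide)
  have a10 := ha 10 (by decide)
  have a11 := ha 11 (by decide)
  have a12 := ha 12 (by decide)
  have a13 := ha 13 (by decide)
  obtain ⟨h1, h2, h3, h4, h5, h6, h7, h8, h9, h10, h11, h12, h13, h14, h15⟩ := h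
  constructor <;> simpa only [r0, r1, r2, r4, r5, r6, r7, r8, r9, a0, a9, a10, a11, a12, a13]

/-- The statement leaves the data of the instance alone. -/
def Safe (s : Stmt) : Bool := s.writes.all (10 ≤ ·) && s.stores.all fun j => [1, 2, 3, 4, 5].contains j

theorem State.Inputs.run {I : Instance} {σ : State} (h : σ.Inputs I) {s : Stmt}
    (hs : Safe s = true) : (s.run σ).Inputs I := by
  simp only [Safe, Bool.and_eq_true, List.all_eq_true, decide_eq_true_eq, List.contains_eq_mem] at hs
  refine h.congr (fun x hx => reg_run_of_notMem (fun h' => ?_) σ)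
    fun j hj => arr_run_of_notMem (fun h' => hj (hs.2 j h')) σ
  have := hs.1 x h'
  omega

theorem State.Inputs.setReg {I : Instance} {σ : State} (h : σ.Inputs I) {x : ℕ} (hx : 10 ≤ x)
    (v : ℤ) : (σ.setReg x v).Inputs I :=
  h.congr (fun y hy => State.reg_setReg_of_ne _ (by omega) _) fun _ _ => rfl

/-- With `Emits.upto` and `Emits.single`, this forms a small program logic in which `ρ` records the
indices of the surrounding loops. It reduces the nested loops of `build` to one check for each kind
of arc. -/
theorem Emits.seq {I : Instance} {ρ : List (ℕ × ℤ)} {p q : Stmt} {L L' : List (Arc I)}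
    (hp : Emits I ρ p L) (hq : Emits I ρ q L') (hs : Safe p = true)
    (hρ : ∀ x ∈ ρ, x.1 ∉ p.writes) : Emits I ρ (seq p q) (L ++ L') := by
  intro σ K hI hr hK
  rw [← List.append_assoc]
  exact hq _ _ (hI.run hs) (fun x hx => by rw [reg_run_of_notMem (hρ x hx), hr x hx])
    (hp σ K hI hr hK)

theorem Emits.upto {I : Instance} {ρ : List (ℕ × ℤ)} {i n c : ℕ} {p : Stmt}
    {g : Fin c → List (Arc I)} (hp : ∀ k : Fin c, Emits I ((i, ((k : ℕ) : ℤ)) :: ρ) p (g k))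
    (hn : ∀ σ : State, σ.Inputs I → σ.reg n = c) (hs : Safe p = true) (hi : 10 ≤ i) (hi' : 16 ≠ i)
    (hρ : ∀ x ∈ ρ, x.1 ∉ p.writes ∧ x.1 ≠ i) :
    Emits I ρ (upto i n p) ((List.finRange c).flatMap g) := by
  intro σ K hI hr hK
  have key := run_upto_induction (i := i) (n := n) (σ := σ) (p := p) (c := c)
    (fun k τ => τ.Inputs I ∧ (∀ q ∈ ρ, τ.reg q.1 = q.2) ∧
      τ.Holds (K ++ ((List.finRange c).take k.toNat).flatMap g))
    (hn σ hI) (by omega) ?_ ?_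
  · have e : (List.finRange c).take c = List.finRange c := List.take_of_length_le (by simp)
    simpa [e] using key.2.2
  · exact ⟨hI.setReg hi 0, fun q hq => by rw [State.reg_setReg_of_ne _ (hρ q hq).2, hr q hq],
      by simpa using hK.setReg hi' 0⟩
  · rintro k τ hk0 hkc hk ⟨h1, h2, h3⟩
    obtain ⟨k, rfl⟩ := Int.eq_ofNat_of_zero_le hk0
    have hkc' : k < c := by omega
    refine ⟨(h1.run hs).setReg hi _, fun q hq => ?_, State.Holds.setReg ?_ hi' _⟩
    · rw [State.reg_setReg_of_ne _ (hρ q hq).2, reg_run_of_notMem (hρ q hq).1, h2 q hq]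
    · have := hp ⟨k, hkc'⟩ τ _ h1 (by
        intro q hq
        rcases List.mem_cons.1 hq with rfl | hq
        · exact hk
        · exact h2 q hq) h3
      have e1 : ((k : ℤ) + 1).toNat = k + 1 := by omega
      have e2 : (List.finRange c).take (k + 1) = (List.finRange c).take k ++ [⟨k, hkc'⟩] := by
        rw [List.take_succ_eq_append_getElem (by simpa using hkc')]
        simp
      rw [e1, e2, List.flatMap_append]
      simpa using this

theorem Emits.single {I : Instance} {ρ : List (ℕ × ℤ)} {p : Stmt} (a : Arc I)
    (h16 : 16 ∉ p.writes) (hst : p.stores = [])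
    (h : ∀ σ : State, σ.Inputs I → (∀ q ∈ ρ, σ.reg q.1 = q.2) → (p.run σ).reg 20 = a.tail ∧
      (p.run σ).reg 21 = a.head ∧ (p.run σ).reg 15 = a.cap ∧ (p.run σ).reg 22 = a.reward) :
    Emits I ρ (Stmt.seq p emit) [a] := by
  intro σ K hI hr hK
  obtain ⟨h1, h2, h3, h4⟩ := h σ hI hr
  refine emit_spec ⟨by rw [reg_run_of_notMem h16, hK.length], fun k hk => ?_⟩ a h1 h2 h3 h4
  have ha : (p.run σ).arr = σ.arr := by funext j; exact arr_run_of_notMem (by simp [hst]) σ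
  rw [ha]
  exact hK.arc k hk

/-- The address of the node at which resources arrive at the demand in the register `x`. -/
def inNodeExpr (x : ℕ) : Expr := .add (.reg 5) (.reg x)

/-- The address of the node from which resources leave the demand in the register `x`. -/
def outNodeExpr (x : ℕ) : Expr := .add (.add (.reg 5) (.reg 0)) (.reg x)

/-- The node of the resource type in the register 10 at the location in the register 11. -/
def supplyNodeExpr : Expr := .add (.arr 9 (.reg 10)) (.reg 11)

/-- The entry of the matrix with the row addresses in the array `j`. -/
def entry (j : Fin 16) (x y : ℕ) : Expr := inp (.add (.arr j (.reg x)) (.reg y))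

/-- The entry of the vector whose address is in the register `b`. -/
def coord (b x : ℕ) : Expr := inp (.add (.reg b) (.reg x))

/-- Emitting the arc `y d`. -/
def emitY : Stmt := seq (block [assign 20 (inNodeExpr 10), assign 21 (outNodeExpr 10),
  assign 22 (coord 8 10), assign 15 (.const 0)]) emit

/-- Emitting the arc `start r s d`. -/
def emitStart : Stmt := seq (block [assign 20 supplyNodeExpr, assign 21 (inNodeExpr 12),
  -- Tests are strict, so over the integers the condition `f ≤ τ` becomes `0 < τ + 1 - f`.
  assign 22 (.const 0), test [.sub (.add (coord 6 12) (.const 1)) (entry 12 11 12),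
    entry 9 10 11, entry 11 12 10]]) emit

/-- Emitting the arc `move r i j`. -/
def emitMove : Stmt := seq (block [assign 20 (outNodeExpr 11), assign 21 (inNodeExpr 12),
  assign 22 (.const 0), test [.sub (.add (coord 6 12) (.const 1))
    (.add (.add (coord 6 11) (coord 7 11)) (entry 13 11 12)), entry 11 11 10, entry 11 12 10]]) emit

/-- Emitting the arc `last r d`. -/
def emitLast : Stmt := seq (block [assign 20 (outNodeExpr 11), assign 21 (.const 0),
  assign 22 (.const 0), test [entry 11 11 10]]) emit

/-- Emitting the arc `supply r s`. -/
def emitSupply : Stmt := seq (block [assign 20 (.const 0), assign 21 supplyNodeExpr,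
  assign 22 (.const 0), assign 15 (entry 10 10 11)]) emit

/-- Emitting the arc `pass d`. -/
def emitPass : Stmt := seq (block [assign 20 (inNodeExpr 10), assign 21 (outNodeExpr 10),
  assign 22 (.const 0), assign 15 (.reg 4)]) emit

/-- Building the network. -/
def build : Stmt := seq (upto 10 0 emitY) (seq (seq (seq (seq
  (upto 10 1 (upto 11 2 (upto 12 0 emitStart))) (upto 10 1 (upto 11 0 (upto 12 0 emitMove))))
  (upto 10 1 (upto 11 0 emitLast))) (upto 10 1 (upto 11 2 emitSupply))) (upto 10 0 emitPass))

theorem zero_lt_ite_iff (P : Prop) [Decidable P] : (0 : ℤ) < (if P then 1 else 0) ↔ P := by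
  split_ifs with h <;> simp [h]

theorem emitY_spec {I : Instance} (d : Fin I.nD) : Emits I [(10, ((d : ℕ) : ℤ))] emitY [.y d] := by
  refine Emits.single _ (by decide) rfl fun σ hI hr => ?_
  simp only [List.forall_mem_cons, List.not_mem_nil, false_implies, implies_true, and_true] at hr
  simp [block, run, inNodeExpr, outNodeExpr, coord, inp, hr, hI.base, hI.nD, hI.w, Arc.tail,
    Arc.head, Arc.cap, Arc.reward, Instance.inNode, Instance.outNode]

theorem emitPass_spec {I : Instance} (d : Fin I.nD) :
    Emits I [(10, ((d : ℕ) : ℤ))] emitPass [.pass d] := by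
  refine Emits.single _ (by decide) rfl fun σ hI hr => ?_
  simp only [List.forall_mem_cons, List.not_mem_nil, false_implies, implies_true, and_true] at hr
  simp [block, run, inNodeExpr, outNodeExpr, hr, hI.base, hI.nD, hI.cnt, Arc.tail,
    Arc.head, Arc.cap, Arc.reward, Instance.inNode, Instance.outNode]

theorem emitSupply_spec {I : Instance} (r : Fin I.nR) (s : Fin I.nS) :
    Emits I [(11, ((s : ℕ) : ℤ)), (10, ((r : ℕ) : ℤ))] emitSupply [.supply r s] := by
  refine Emits.single _ (by decide) rfl fun σ hI hr => ?_
  simp only [List.forall_mem_cons, List.not_mem_nil, false_implies, implies_true, and_true] at hr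
  have := hI.l r s
  simp [block, run, supplyNodeExpr, entry, inp, hr, hI.row, this, Arc.tail,
    Arc.head, Arc.cap, Arc.reward, Instance.supplyNode]

theorem emitLast_spec {I : Instance} (r : Fin I.nR) (d : Fin I.nD) :
    Emits I [(11, ((d : ℕ) : ℤ)), (10, ((r : ℕ) : ℤ))] emitLast [.last r d] := by
  refine Emits.single _ (by decide) rfl fun σ hI hr => ?_
  simp only [List.forall_mem_cons, List.not_mem_nil, false_implies, implies_true, and_true] at hr
  have := hI.M d r
  simp [block, run, outNodeExpr, entry, inp, hr, hI.base, hI.nD, this, Arc.tail, Arc.head, Arc.cap,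
    Arc.reward, Instance.outNode, reg_run_test, reg_run_test_of_ne, zero_lt_ite_iff]

theorem emitStart_spec {I : Instance} (r : Fin I.nR) (s : Fin I.nS) (d : Fin I.nD) :
    Emits I [(12, ((d : ℕ) : ℤ)), (11, ((s : ℕ) : ℤ)), (10, ((r : ℕ) : ℤ))] emitStart
      [.start r s d] := by
  refine Emits.single _ (by decide) rfl fun σ hI hr => ?_
  simp only [List.forall_mem_cons, List.not_mem_nil, false_implies, implies_true, and_true] at hr
  have h1 := hI.M d r
  have h2 := hI.S r s
  have h3 := hI.τ d
  have h4 := hI.fS s d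
  rw [hI.row] at h2
  simp [block, run, supplyNodeExpr, inNodeExpr, entry, coord, inp, hr, hI.base, hI.row, h1, h2, h3,
    h4, Arc.tail, Arc.head, Arc.cap, Arc.reward, Instance.inNode, Instance.supplyNode,
    reg_run_test, reg_run_test_of_ne, zero_lt_ite_iff]
  exact @if_congr _ _ _ _ (Classical.propDecidable _) _ _ _ _ Iff.rfl rfl rfl

theorem emitMove_spec {I : Instance} (r : Fin I.nR) (i j : Fin I.nD) :
    Emits I [(12, ((j : ℕ) : ℤ)), (11, ((i : ℕ) : ℤ)), (10, ((r : ℕ) : ℤ))] emitMove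
      [.move r i j] := by
  refine Emits.single _ (by decide) rfl fun σ hI hr => ?_
  simp only [List.forall_mem_cons, List.not_mem_nil, false_implies, implies_true, and_true] at hr
  have h1 := hI.M i r
  have h2 := hI.M j r
  have h3 := hI.τ i
  have h4 := hI.τ j
  have h5 := hI.Δ i
  have h6 := hI.fD i j
  simp [block, run, outNodeExpr, inNodeExpr, entry, coord, inp, hr, hI.base, hI.nD, h1, h2, h3,
    h4, h5, h6, Arc.tail, Arc.head, Arc.cap, Arc.reward, Instance.inNode, Instance.outNode,
    reg_run_test, reg_run_test_of_ne, zero_lt_ite_iff, Instance.A]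
  -- The program does not test whether the intersection is nonempty: the type `r` itself lies in it.
  refine if_congr ⟨fun h => ⟨⟨h.1, r, Finset.mem_inter.2 h.2⟩, h.2⟩, fun h => ⟨h.1.1, h.2⟩⟩ rfl rfl

theorem build_spec {I : Instance} {σ : State} (hI : σ.Inputs I) (h16 : σ.reg 16 = 0) :
    (build.run σ).Holds (Arc.list I) := by
  have hn : ∀ σ : State, σ.Inputs I → σ.reg 0 = I.nD := fun _ h => h.nD
  have hr : ∀ σ : State, σ.Inputs I → σ.reg 1 = I.nR := fun _ h => h.nR
  have hs : ∀ σ : State, σ.Inputs I → σ.reg 2 = I.nS := fun _ h => h.nS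
  have h : Emits I [] build (Arc.list I) := by
    refine .seq (.upto (fun d => emitY_spec d) hn ?_ ?_ ?_ ?_) (.seq (.seq (.seq (.seq
      (.upto (fun r => .upto (fun s => .upto (fun d => emitStart_spec r s d)
        hn ?_ ?_ ?_ ?_) hs ?_ ?_ ?_ ?_) hr ?_ ?_ ?_ ?_)
      (.upto (fun r => .upto (fun s => .upto (fun d => emitMove_spec r s d)
        hn ?_ ?_ ?_ ?_) hn ?_ ?_ ?_ ?_) hr ?_ ?_ ?_ ?_) ?_ ?_)
      (.upto (fun r => .upto (fun d => emitLast_spec r d) hn ?_ ?_ ?_ ?_) hr ?_ ?_ ?_ ?_) ?_ ?_)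
      (.upto (fun r => .upto (fun s => emitSupply_spec r s) hs ?_ ?_ ?_ ?_) hr ?_ ?_ ?_ ?_) ?_ ?_)
      (.upto (fun d => emitPass_spec d) hn ?_ ?_ ?_ ?_) ?_ ?_) ?_ ?_
    all_goals first
      | decide
      | (simp only [List.forall_mem_cons, List.not_mem_nil, false_implies, implies_true, and_true]
         decide)
  simpa using h σ [] hI (by simp) ⟨by simpa using h16, fun k hk => by simp at hk⟩

/-! ### Flows in the network and solutions of the integer program -/

theorem nodup_flatMap_of_inj {α β : Type*} {l : List α} (hl : l.Nodup) {g : α → List β}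
    (hg : ∀ a, (g a).Nodup) (key : ∀ a a' b, b ∈ g a → b ∈ g a' → a = a') : (l.flatMap g).Nodup := by
  rw [List.nodup_flatMap]
  refine ⟨fun a _ => hg a, hl.imp fun {a a'} hne => ?_⟩
  exact fun b h h' => hne (key a a' b h h')

theorem sum_map_flatMap_finRange {α : Type*} {n : ℕ} (g : Fin n → List α) (G : α → ℤ) :
    (((List.finRange n).flatMap g).map G).sum = ∑ i, ((g i).map G).sum := by
  rw [Fin.sum_univ_def]
  generalize List.finRange n = l
  induction l with
  | nil => rfl
  | cons a l ih => simp [ih]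

namespace Arc

variable {I : Instance}

/-- Without repetitions, positions in the list and arcs correspond, so a flow array can be read as a
function on arcs. -/
theorem nodup_list (I : Instance) : (list I).Nodup := by
  have hf : ∀ n, (List.finRange n).Nodup := List.nodup_finRange
  have h1 : (yList I).Nodup := nodup_flatMap_of_inj (hf _) (by simp) (by simp)
  have h2 : (restList I).Nodup := by
    refine List.Nodup.append (List.Nodup.append (List.Nodup.append (List.Nodup.append
      ?_ ?_ ?_) ?_ ?_) ?_ ?_) ?_ ?_
    · exact nodup_flatMap_of_inj (hf _) (fun _ => nodup_flatMap_of_inj (hf _) (fun _ =>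
        nodup_flatMap_of_inj (hf _) (by simp) (by simp)) (by simp)) (by
          intro a a' b h h'
          cases b <;> simp_all)
    · exact nodup_flatMap_of_inj (hf _) (fun _ => nodup_flatMap_of_inj (hf _) (fun _ =>
        nodup_flatMap_of_inj (hf _) (by simp) (by simp)) (by simp)) (by
          intro a a' b h h'
          cases b <;> simp_all)
    · rintro a ha hb
      cases a <;> simp at ha hb
    · exact nodup_flatMap_of_inj (hf _) (fun _ => nodup_flatMap_of_inj (hf _) (by simp) (by simp))
        (by simp)
    · rintro a ha hb
      cases a <;> simp at ha hb
    · exact nodup_flatMap_of_inj (hf _) (fun _ => nodup_flatMap_of_inj (hf _) (by simp) (by simp))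
        (by simp)
    · rintro a ha hb
      cases a <;> simp at ha hb
    · exact nodup_flatMap_of_inj (hf _) (by simp) (by simp)
    · rintro a ha hb
      cases a <;> simp at ha hb
  refine List.Nodup.append h1 h2 ?_
  rintro a ha hb
  cases a <;> simp [yList, restList] at ha hb

theorem mem_list (a : Arc I) : a ∈ list I := by
  cases a <;> simp [list, yList, restList]

theorem sum_list (G : Arc I → ℤ) : ((list I).map G).sum = ∑ d, G (y d) +
    (∑ r, ∑ s, ∑ d, G (start r s d) + ∑ r, ∑ i, ∑ j, G (move r i j) + ∑ r, ∑ d, G (last r d) +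
      ∑ r, ∑ s, G (supply r s) + ∑ d, G (pass d)) := by
  simp only [list, yList, restList, List.map_append, List.sum_append, sum_map_flatMap_finRange,
    List.map_cons, List.map_nil, List.sum_cons, List.sum_nil, add_zero]

theorem length_list (I : Instance) : (list I).length = I.nD + (I.nR * (I.nS * I.nD) +
    I.nR * (I.nD * I.nD) + I.nR * I.nD + I.nR * I.nS + I.nD) := by
  simp [list, yList, restList, List.length_flatMap]
  ring

end Arc

/-! ### The numbering of the nodes is injective -/

namespace Instance

variable (I : Instance)

theorem supplyNode_inj {r r' : Fin I.nR} {s s' : Fin I.nS} :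
    I.supplyNode r s = I.supplyNode r' s' ↔ r = r' ∧ s = s' := by
  refine ⟨fun h => ?_, fun h => by rw [h.1, h.2]⟩
  have h' : (r : ℕ) * I.nS + s = r' * I.nS + s' := by
    simp only [supplyNode] at h
    have : ((r : ℕ) * I.nS + s : ℤ) = (r' : ℕ) * I.nS + s' := by linarith
    exact_mod_cast this
  have h1 := lt_mul_of_fin r s
  have h2 := lt_mul_of_fin r' s'
  have e : (⟨r * I.nS + s, h1⟩ : Fin (I.nR * I.nS)) = ⟨r' * I.nS + s', h2⟩ := Fin.ext h'
  exact ⟨by rw [← divNat_mk r s h1, e, divNat_mk], by rw [← modNat_mk r s h1, e, modNat_mk]⟩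

theorem supplyNode_lt (r : Fin I.nR) (s : Fin I.nS) :
    3 ≤ I.supplyNode r s ∧ I.supplyNode r s < 3 + I.nR * I.nS := by
  have h : ((r : ℕ) * I.nS + (s : ℕ) : ℤ) < I.nR * I.nS := by exact_mod_cast lt_mul_of_fin r s
  have h' : (0 : ℤ) ≤ (r : ℕ) * I.nS := by positivity
  constructor <;> simp only [supplyNode] <;> omega

theorem inNode_lt (d : Fin I.nD) :
    3 + I.nR * I.nS ≤ I.inNode d ∧ I.inNode d < 3 + I.nR * I.nS + I.nD := by
  have := d.isLt
  constructor <;> simp only [inNode] <;> omega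

theorem outNode_lt (d : Fin I.nD) : 3 + I.nR * I.nS + I.nD ≤ I.outNode d ∧
    I.outNode d < 3 + I.nR * I.nS + 2 * I.nD := by
  have := d.isLt
  constructor <;> simp only [outNode] <;> omega

theorem three_le : (3 : ℤ) ≤ 3 + I.nR * I.nS := by
  have : (0 : ℤ) ≤ I.nR * I.nS := by positivity
  omega

@[simp] theorem inNode_eq {d d' : Fin I.nD} : I.inNode d = I.inNode d' ↔ d = d' := by
  simp [inNode, Fin.ext_iff]

@[simp] theorem outNode_eq {d d' : Fin I.nD} : I.outNode d = I.outNode d' ↔ d = d' := by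
  simp [outNode, Fin.ext_iff]

theorem inNode_ne_outNode (d d' : Fin I.nD) : I.inNode d ≠ I.outNode d' := by
  have h1 := I.inNode_lt d
  have h2 := I.outNode_lt d'
  omega

theorem supplyNode_ne_inNode (r : Fin I.nR) (s : Fin I.nS) (d : Fin I.nD) :
    I.supplyNode r s ≠ I.inNode d := by
  have h1 := I.supplyNode_lt r s
  have h2 := I.inNode_lt d
  omega

theorem supplyNode_ne_outNode (r : Fin I.nR) (s : Fin I.nS) (d : Fin I.nD) :
    I.supplyNode r s ≠ I.outNode d := by
  have h1 := I.supplyNode_lt r s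
  have h2 := I.outNode_lt d
  omega

theorem supplyNode_ne_zero (r : Fin I.nR) (s : Fin I.nS) : I.supplyNode r s ≠ 0 := by
  have h1 := I.supplyNode_lt r s
  omega

theorem inNode_ne_zero (d : Fin I.nD) : I.inNode d ≠ 0 := by
  have h1 := I.inNode_lt d
  have := I.three_le
  omega

theorem outNode_ne_zero (d : Fin I.nD) : I.outNode d ≠ 0 := by
  have h1 := I.outNode_lt d
  have := I.three_le
  omega

end Instance

/-! ### Net flow at the nodes -/

namespace Arc

variable {I : Instance}

/-- The capacity of an arc. -/
noncomputable def cap' : Arc I → ℤ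
  | y _ => 1
  | a => a.cap

/-- The net outflow at a node. -/
noncomputable def netflow (v : Arc I → ℤ) (x : ℤ) : ℤ :=
  ((list I).map fun a => v a * ((if a.tail = x then 1 else 0) - (if a.head = x then 1 else 0))).sum

theorem tail_mem (a : Arc I) : 0 ≤ a.tail ∧ a.tail < 3 + I.nR * I.nS + 2 * I.nD := by
  have := I.three_le
  cases a with
  | y d => have := I.inNode_lt d; simp only [tail]; omega
  | start r s d => have := I.supplyNode_lt r s; simp only [tail]; omega
  | move r i j => have := I.outNode_lt i; simp only [tail]; omega
  | last r d => have := I.outNode_lt d; simp only [tail]; omega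
  | supply r s => simp only [tail]; omega
  | pass d => have := I.inNode_lt d; simp only [tail]; omega

theorem head_mem (a : Arc I) : 0 ≤ a.head ∧ a.head < 3 + I.nR * I.nS + 2 * I.nD := by
  have := I.three_le
  cases a with
  | y d => have := I.outNode_lt d; simp only [head]; omega
  | start r s d => have := I.inNode_lt d; simp only [head]; omega
  | move r i j => have := I.inNode_lt j; simp only [head]; omega
  | last r d => simp only [head]; omega
  | supply r s => have := I.supplyNode_lt r s; simp only [head]; omega
  | pass d => have := I.outNode_lt d; simp only [head]; omega

theorem netflow_inNode (v : Arc I → ℤ) (d : Fin I.nD) : netflow v (I.inNode d) =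
    v (y d) + v (pass d) - ∑ r, (∑ s, v (start r s d) + ∑ i, v (move r i d)) := by
  simp [netflow, sum_list, tail, head, I.supplyNode_ne_inNode, (I.inNode_ne_outNode _ _).symm,
    (I.inNode_ne_zero _).symm, Finset.sum_add_distrib]
  ring

theorem netflow_outNode (v : Arc I → ℤ) (d : Fin I.nD) : netflow v (I.outNode d) =
    ∑ r, (∑ j, v (move r d j) + v (last r d)) - (v (y d) + v (pass d)) := by
  simp [netflow, sum_list, tail, head, I.supplyNode_ne_outNode, I.inNode_ne_outNode,
    (I.outNode_ne_zero _).symm, Finset.sum_add_distrib]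
  ring

theorem netflow_supplyNode (v : Arc I → ℤ) (r : Fin I.nR) (s : Fin I.nS) :
    netflow v (I.supplyNode r s) = ∑ d, v (start r s d) - v (supply r s) := by
  simp [netflow, sum_list, tail, head, (I.supplyNode_ne_outNode _ _ _).symm,
    (I.supplyNode_ne_inNode _ _ _).symm, (I.supplyNode_ne_zero _ _).symm, I.supplyNode_inj,
    ite_and]
  ring

theorem netflow_zero (v : Arc I → ℤ) :
    netflow v 0 = ∑ r, ∑ s, v (supply r s) - ∑ r, ∑ d, v (last r d) := by
  simp [netflow, sum_list, tail, head, I.supplyNode_ne_zero, I.inNode_ne_zero, I.outNode_ne_zero]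
  ring

/-- No arc meets any other integer, in particular neither 1 nor 2. -/
theorem netflow_eq_zero {v : Arc I → ℤ} (h0 : netflow v 0 = 0)
    (h1 : ∀ r s, netflow v (I.supplyNode r s) = 0) (h2 : ∀ d, netflow v (I.inNode d) = 0)
    (h3 : ∀ d, netflow v (I.outNode d) = 0) (x : ℤ) : netflow v x = 0 := by
  by_cases e0 : x = 0
  · rw [e0, h0]
  by_cases e1 : ∃ r s, x = I.supplyNode r s
  · obtain ⟨r, s, rfl⟩ := e1; exact h1 r s
  by_cases e2 : ∃ d, x = I.inNode d
  · obtain ⟨d, rfl⟩ := e2; exact h2 d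
  by_cases e3 : ∃ d, x = I.outNode d
  · obtain ⟨d, rfl⟩ := e3; exact h3 d
  push Not at e1 e2 e3
  have ht : ∀ a : Arc I, a.tail ≠ x ∧ a.head ≠ x := by
    intro a
    cases a <;> simp [tail, head, (e1 _ _).symm, (e2 _).symm, (e3 _).symm, Ne.symm e0]
  simp [netflow, ht]

end Arc

/-- A circulation in the network that respects the capacities. -/
structure IsCirculation {I : Instance} (v : Arc I → ℤ) : Prop where
  nonneg : ∀ a, 0 ≤ v a
  le_cap : ∀ a, v a ≤ a.cap'
  netflow : ∀ x, Arc.netflow v x = 0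

/-- The solution given by a flow. -/
def toSolution {I : Instance} (v : Arc I → ℤ) : I.Solution where
  y d := v (.y d)
  xS r s d := v (.start r s d)
  xD r i j := v (.move r i j)
  xT r d := v (.last r d)

/-- The flow given by a solution. -/
def ofSolution {I : Instance} (X : I.Solution) : Arc I → ℤ
  | .y d => X.y d
  | .start r s d => X.xS r s d
  | .move r i j => X.xD r i j
  | .last r d => X.xT r d
  | .supply r s => ∑ d, X.xS r s d
  | .pass d => ∑ r, (∑ s, X.xS r s d + ∑ i, X.xD r i d) - X.y d

variable {I : Instance}

theorem eq_zero_or_of_le_ite {a : ℤ} {P : Prop} {_ : Decidable P} (h0 : 0 ≤ a)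
    (h1 : a ≤ if P then 1 else 0) : a = 0 ∨ (a = 1 ∧ P) := by
  split_ifs at h1 with h
  · rcases (by omega : a = 0 ∨ a = 1) with h' | h'
    · exact .inl h'
    · exact .inr ⟨h', h⟩
  · exact .inl (by omega)

/-- The nodes of a demand do not distinguish types. As the demand requires one type, flow of any
other type there is 0, and each sum over all types collapses to a single term. -/
theorem IsCirculation.feasible {v : Arc I → ℤ} (hv : IsCirculation v) (hI : I.IsmR1D) :
    (toSolution v).Feasible := by
  have hS : ∀ r s d, v (.start r s d) = 0 ∨ (v (.start r s d) = 1 ∧ I.B r s d) := fun r s d =>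
    eq_zero_or_of_le_ite (hv.nonneg _) (hv.le_cap (.start r s d))
  have hD : ∀ r i j, v (.move r i j) = 0 ∨
      (v (.move r i j) = 1 ∧ I.A i j ∧ r ∈ I.M i ∩ I.M j) := fun r i j =>
    eq_zero_or_of_le_ite (hv.nonneg _) (hv.le_cap (.move r i j))
  have hT : ∀ r d, v (.last r d) = 0 ∨ (v (.last r d) = 1 ∧ r ∈ I.M d) := fun r d =>
    eq_zero_or_of_le_ite (hv.nonneg _) (hv.le_cap (.last r d))
  have hin : ∀ i, ∀ r ∈ I.M i, ∑ r', (∑ s, v (.start r' s i) + ∑ h, v (.move r' h i)) =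
      ∑ s, v (.start r s i) + ∑ h, v (.move r h i) := by
    intro i r hr
    refine Finset.sum_eq_single r (fun r' _ hne => ?_) (by simp)
    have hr' : r' ∉ I.M i := fun h => hne (Finset.card_le_one.1 (hI i).le r' h r hr)
    rw [Finset.sum_eq_zero, Finset.sum_eq_zero, add_zero]
    · exact fun h _ => (hD r' h i).resolve_right fun h => hr' (Finset.mem_inter.1 h.2.2).2
    · exact fun s _ => (hS r' s i).resolve_right fun h => hr' h.2.2.2
  have hout : ∀ i, ∀ r ∈ I.M i, ∑ r', (∑ j, v (.move r' i j) + v (.last r' i)) =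
      ∑ j, v (.move r i j) + v (.last r i) := by
    intro i r hr
    refine Finset.sum_eq_single r (fun r' _ hne => ?_) (by simp)
    have hr' : r' ∉ I.M i := fun h => hne (Finset.card_le_one.1 (hI i).le r' h r hr)
    rw [Finset.sum_eq_zero, zero_add]
    · exact (hT r' i).resolve_right fun h => hr' h.2
    · exact fun h _ => (hD r' i h).resolve_right fun h => hr' (Finset.mem_inter.1 h.2.2).1
  refine ⟨fun r s hs => ?_, fun i r hr => ?_, fun i r hr => ?_, fun d => ?_, hS, hD, hT⟩
  · have h1 := hv.netflow (I.supplyNode r s)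
    rw [Arc.netflow_supplyNode] at h1
    have h2 := hv.le_cap (.supply r s)
    simp only [Arc.cap', Arc.cap, if_pos hs] at h2
    simp only [toSolution]
    omega
  · have h1 := hv.netflow (I.inNode i)
    have h2 := hv.netflow (I.outNode i)
    rw [Arc.netflow_inNode, hin i r hr] at h1
    rw [Arc.netflow_outNode, hout i r hr] at h2
    simp only [toSolution]
    omega
  · have h1 := hv.netflow (I.inNode i)
    rw [Arc.netflow_inNode, hin i r hr] at h1
    have := hv.nonneg (.pass i)
    simp only [toSolution]
    omega
  · have h1 := hv.nonneg (.y d)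
    have h2 : v (.y d) ≤ 1 := hv.le_cap (.y d)
    simp only [toSolution]
    omega

theorem le_ite_of_eq_zero_or {a : ℤ} {P : Prop} {_ : Decidable P} (h : a = 0 ∨ (a = 1 ∧ P)) :
    0 ≤ a ∧ a ≤ if P then 1 else 0 := by
  rcases h with rfl | ⟨rfl, h⟩
  · split_ifs <;> simp
  · simp [h]

/-- The arcs `supply` and `pass` carry exactly what balances the supply nodes and the in-nodes; the
`service` constraint makes `pass` nonnegative. -/
theorem isCirculation_ofSolution {X : I.Solution} (hX : X.Feasible) (hI : I.IsmR1D) :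
    IsCirculation (ofSolution X) := by
  have hS : ∀ r s d, 0 ≤ X.xS r s d ∧ X.xS r s d ≤ (Arc.start r s d).cap' := fun r s d =>
    le_ite_of_eq_zero_or (hX.xS_binary r s d)
  have hD : ∀ r i j, 0 ≤ X.xD r i j ∧ X.xD r i j ≤ (Arc.move r i j).cap' := fun r i j =>
    le_ite_of_eq_zero_or (hX.xD_binary r i j)
  have hT : ∀ r d, 0 ≤ X.xT r d ∧ X.xT r d ≤ (Arc.last r d).cap' := fun r d =>
    le_ite_of_eq_zero_or (hX.xT_binary r d)
  have hy : ∀ d, 0 ≤ X.y d ∧ X.y d ≤ 1 := fun d => by rcases hX.y_binary d with h | h <;> simp [h]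
  have hS1 : ∀ r s d, X.xS r s d ≤ 1 := fun r s d => by
    rcases hX.xS_binary r s d with h | h <;> simp [h]
  have hD1 : ∀ r i j, X.xD r i j ≤ 1 := fun r i j => by
    rcases hX.xD_binary r i j with h | h <;> simp [h]
  have hcons : ∀ i r, ∑ s, X.xS r s i + ∑ h, X.xD r h i = ∑ j, X.xD r i j + X.xT r i := by
    intro i r
    by_cases hr : r ∈ I.M i
    · exact hX.conservation i r hr
    · rw [Finset.sum_eq_zero, Finset.sum_eq_zero, Finset.sum_eq_zero,
        (hX.xT_binary r i).resolve_right fun h => hr h.2]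
      · exact fun h _ => (hX.xD_binary r i h).resolve_right fun h => hr (Finset.mem_inter.1 h.2.2).1
      · exact fun h _ => (hX.xD_binary r h i).resolve_right fun h => hr (Finset.mem_inter.1 h.2.2).2
      · exact fun s _ => (hX.xS_binary r s i).resolve_right fun h => hr h.2.2.2
  have hserve : ∀ d, X.y d ≤ ∑ r, (∑ s, X.xS r s d + ∑ i, X.xD r i d) := by
    intro d
    obtain ⟨r, hr⟩ : (I.M d).Nonempty := Finset.card_pos.1 (by rw [hI d]; exact one_pos)
    refine (hX.service d r hr).trans (Finset.single_le_sum
      (f := fun r => ∑ s, X.xS r s d + ∑ i, X.xD r i d) (fun r' _ => ?_) (Finset.mem_univ r))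
    exact add_nonneg (Finset.sum_nonneg fun s _ => (hS r' s d).1)
      (Finset.sum_nonneg fun i _ => (hD r' i d).1)
  -- The capacity of `pass d` never binds: the inflow is at most `nR * (nS + nD)`, and `cnt` is a
  -- larger number that is already at hand in a register.
  have hbig : ∀ d, ∑ r, (∑ s, X.xS r s d + ∑ i, X.xD r i d) ≤ I.cnt := by
    intro d
    have h1 : ∀ r ∈ (Finset.univ : Finset (Fin I.nR)), ∑ s, X.xS r s d + ∑ i, X.xD r i d ≤
        (I.nS + I.nD : ℤ) := by
      intro r _
      refine add_le_add ((Finset.sum_le_sum fun s _ => hS1 r s d).trans ?_)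
        ((Finset.sum_le_sum fun i _ => hD1 r i d).trans ?_) <;> simp
    refine (Finset.sum_le_sum h1).trans ?_
    simp only [Finset.sum_const, Finset.card_univ, Fintype.card_fin, nsmul_eq_mul, Instance.cnt]
    have h1 : (0 : ℤ) ≤ I.nD := by omega
    have h2 : (0 : ℤ) ≤ I.nR := by omega
    have h3 : (0 : ℤ) ≤ I.nS := by omega
    nlinarith [mul_nonneg h1 h2, mul_nonneg h2 h3, mul_nonneg h1 h3, mul_nonneg h1 h1,
      mul_nonneg h2 h2, mul_nonneg h3 h3]
  refine ⟨fun a => ?_, fun a => ?_, fun x => Arc.netflow_eq_zero ?_ (fun r s => ?_) (fun d => ?_)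
    (fun d => ?_) x⟩
  · cases a with
    | y d => exact (hy d).1
    | start r s d => exact (hS r s d).1
    | move r i j => exact (hD r i j).1
    | last r d => exact (hT r d).1
    | supply r s => exact Finset.sum_nonneg fun d _ => (hS r s d).1
    | pass d => exact sub_nonneg.2 (hserve d)
  · cases a with
    | y d => exact (hy d).2
    | start r s d => exact (hS r s d).2
    | move r i j => exact (hD r i j).2
    | last r d => exact (hT r d).2
    | supply r s =>
      simp only [Arc.cap', Arc.cap, ofSolution]
      by_cases hs : s ∈ I.S r
      · rw [if_pos hs]; exact hX.supply r s hs
      · rw [if_neg hs]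
        exact (Finset.sum_eq_zero fun d _ =>
          (hX.xS_binary r s d).resolve_right fun h => hs h.2.2.1).le
    | pass d =>
      have := hbig d
      have := (hy d).1
      simp only [Arc.cap', Arc.cap, ofSolution]
      omega
  · rw [Arc.netflow_zero]
    simp only [ofSolution]
    rw [← Finset.sum_sub_distrib]
    refine Finset.sum_eq_zero fun r _ => ?_
    -- Balance at the depot follows by adding the conservation laws of all demands: the flow between
    -- demands occurs on both sides and cancels.
    have h := Finset.sum_congr rfl fun i (_ : i ∈ Finset.univ) => hcons i r
    rw [Finset.sum_add_distrib, Finset.sum_add_distrib, Finset.sum_comm,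
      Finset.sum_comm (f := fun i h => X.xD r h i)] at h
    omega
  · rw [Arc.netflow_supplyNode]; simp [ofSolution]
  · rw [Arc.netflow_inNode]; simp [ofSolution]
  · rw [Arc.netflow_outNode]
    simp only [ofSolution, ← hcons d]
    ring

theorem sum_Ico_eq_sum_list {α : Type*} (L : List α) (F : ℤ → ℤ) (G : α → ℤ)
    (h : ∀ (k : ℕ) (hk : k < L.length), F k = G L[k]) :
    ∑ e ∈ Finset.Ico (0 : ℤ) L.length, F e = (L.map G).sum := by
  have h1 : (L.map G).sum = ∑ k : Fin L.length, F (k : ℕ) := by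
    rw [← List.sum_ofFn]
    congr 1
    refine List.ext_getElem (by simp) fun k hk _ => ?_
    simp [h k (by simpa using hk)]
  rw [h1, Fin.sum_univ_eq_sum_range (fun k => F k)]
  have h2 : Finset.Ico (0 : ℤ) L.length = (Finset.range L.length).map Nat.castEmbedding := by
    ext e
    simp only [Finset.mem_Ico, Finset.mem_map, Finset.mem_range, Nat.castEmbedding_apply]
    constructor
    · rintro ⟨h1, h2⟩; exact ⟨e.toNat, by omega, by omega⟩
    · rintro ⟨k, hk, rfl⟩; omega
  rw [h2, Finset.sum_map]
  rfl

/-- The arcs of the variables precede all others, in the order of the output. So the flow array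
begins with the encoded solution. -/
theorem map_list (v : Arc I → ℤ) : ∃ R, (Arc.list I).map v = (toSolution v).encode ++ R := by
  refine ⟨((List.finRange I.nR).flatMap fun r => (List.finRange I.nS).flatMap fun s =>
    [v (.supply r s)]) ++ (List.finRange I.nD).flatMap fun d => [v (.pass d)], ?_⟩
  simp [Arc.list, Arc.yList, Arc.restList, Instance.Solution.encode, toSolution, listMat, listVec,
    List.map_flatMap, List.ofFn_eq_map, ← List.map_eq_flatMap, Function.comp_def]

/-! ### The algorithm -/

/-- Writing the flow to the output cells. -/
def writeOutput : Stmt := upto 10 16 (store (.reg 10) (.arr 5 (.reg 10)))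

/-- Round `k` reads the cell `16 * k + 5`, while only cells below `k` have been overwritten. The
array can therefore be compacted in place. -/
theorem writeOutput_spec {σ : State} {m : ℤ} (hm : σ.reg 16 = m) (hm0 : 0 ≤ m) {k : ℤ} (hk : 0 ≤ k)
    (hkm : k < m) : (writeOutput.run σ).mem k = σ.arr 5 k := by
  have key := run_upto_induction (i := 10) (n := 16) (σ := σ) (c := m)
    (p := store (.reg 10) (.arr 5 (.reg 10)))
    (fun k τ => (∀ i, 0 ≤ i → i < k → τ.mem i = σ.arr 5 i) ∧ ∀ a, k ≤ a → τ.mem a = σ.mem a)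
    hm hm0 ?_ ?_
  · exact key.1 k hk hkm
  · exact ⟨fun i h1 h2 => by omega, fun a _ => rfl⟩
  · rintro k τ hk0 - hk ⟨h1, h2⟩
    have e1 : (store (.reg 10) (.arr 5 (.reg 10))).run τ = τ.setMem k (σ.arr 5 k) := by
      simp only [run, Expr.val_reg, Expr.val_arr, hk]
      congr 1
      exact h2 _ (by change k ≤ 16 * k + (5 : ℤ); omega)
    rw [e1]
    refine ⟨fun i hi0 hi => ?_, fun a ha => ?_⟩
    · by_cases h : i = k
      · simp [State.setMem, h]
      · simpa [State.setMem, h] using h1 i hi0 (by omega)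
    · have : a ≠ k := by omega
      simpa [State.setMem, this] using h2 a (by omega)

theorem Arc.getElem_list {I : Instance} {k : ℕ} (hk : k < (Arc.list I).length) :
    (k < I.nD ∧ ∃ d, (Arc.list I)[k] = .y d) ∨
      (I.nD ≤ k ∧ (∀ d, (Arc.list I)[k] ≠ .y d) ∧ (Arc.list I)[k].reward = 0) := by
  have hl : (Arc.yList I).length = I.nD := by simp [Arc.yList, List.length_flatMap]
  by_cases h : k < I.nD
  · refine .inl ⟨h, ?_⟩
    have : (Arc.list I)[k] ∈ Arc.yList I := by
      simp only [Arc.list]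
      rw [List.getElem_append_left (by omega)]
      exact List.getElem_mem _
    simp only [Arc.yList, List.mem_flatMap, List.mem_singleton] at this
    obtain ⟨d, -, hd⟩ := this
    exact ⟨d, hd⟩
  · refine .inr ⟨by omega, ?_⟩
    have : (Arc.list I)[k] ∈ Arc.restList I := by
      simp only [Arc.list]
      rw [List.getElem_append_right (by omega)]
      exact List.getElem_mem _
    generalize (Arc.list I)[k] = a at this
    cases a <;> simp [Arc.restList, Arc.reward] at this ⊢

theorem Arc.cap_nonneg {I : Instance} (a : Arc I) : 0 ≤ a.cap := by
  cases a <;> simp only [Arc.cap]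
  case pass d => simp only [Instance.cnt]; positivity
  all_goals first | rfl | (split_ifs <;> omega)

/-- Solving the problem in a state that holds the network. -/
theorem solve_optimal {I : Instance} (hI : I.IsmR1D) {σ : State} (hin : σ.Inputs I)
    (hL : σ.Holds (Arc.list I)) : ∃ v : Arc I → ℤ, (toSolution v).Optimal ∧
      ∀ (k : ℕ) (hk : k < (Arc.list I).length), (solve.run σ).arr 5 k = v (Arc.list I)[k] := by
  classical
  set L := Arc.list I with hLdef
  have hlen : I.nD ≤ L.length := by rw [hLdef, Arc.length_list]; omega
  have harc : ∀ e ∈ Finset.Ico (0 : ℤ) L.length, ∃ (k : ℕ) (hk : k < L.length), e = k := by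
    intro e he
    rw [Finset.mem_Ico] at he
    exact ⟨e.toNat, by omega, by omega⟩
  have h1 : ∀ (k : ℕ) (hk : k < L.length), σ.arr 1 k = L[k].tail := fun k hk => (hL.arc k hk).1
  have h2 : ∀ (k : ℕ) (hk : k < L.length), σ.arr 2 k = L[k].head := fun k hk => (hL.arc k hk).2.1
  have h3 : ∀ (k : ℕ) (hk : k < L.length), σ.arr 3 k = L[k].cap := fun k hk =>
    (hL.arc k hk).2.2.1
  have h4 : ∀ (k : ℕ) (hk : k < L.length), σ.arr 4 k = L[k].reward := fun k hk =>
    (hL.arc k hk).2.2.2.1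
  have h5 : ∀ (k : ℕ) (hk : k < L.length), σ.arr 5 k = 0 := fun k hk => (hL.arc k hk).2.2.2.2
  have hN : (0 : ℤ) ≤ 3 + I.nR * I.nS + 2 * I.nD := by positivity
  have ht : ∀ e ∈ Finset.Ico (0 : ℤ) L.length,
      σ.arr 1 e ∈ Finset.Ico (0 : ℤ) (3 + I.nR * I.nS + 2 * I.nD) := by
    intro e he
    obtain ⟨k, hk, rfl⟩ := harc e he
    rw [h1 k hk, Finset.mem_Ico]
    exact L[k].tail_mem
  have hh : ∀ e ∈ Finset.Ico (0 : ℤ) L.length,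
      σ.arr 2 e ∈ Finset.Ico (0 : ℤ) (3 + I.nR * I.nS + 2 * I.nD) := by
    intro e he
    obtain ⟨k, hk, rfl⟩ := harc e he
    rw [h2 k hk, Finset.mem_Ico]
    exact L[k].head_mem
  obtain ⟨hcap, hK, hdiv⟩ := solve_spec hin.nD (by omega) (by exact_mod_cast hlen) hL.length
    hin.nodes hN ht hh (fun e he => by
      rw [Finset.mem_Ico] at he
      obtain ⟨k, hk, rfl⟩ := harc e (Finset.mem_Ico.2 ⟨he.1, by omega⟩)
      rw [h3 k hk]
      rcases Arc.getElem_list hk with ⟨-, d, hd⟩ | ⟨h, -⟩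
      · rw [hd]; rfl
      · omega) (fun e he => by
      obtain ⟨k, hk, rfl⟩ := harc e he
      rw [h3 k hk]
      exact Arc.cap_nonneg _) (fun e he => by
      rw [Finset.mem_Ico] at he
      obtain ⟨k, hk, rfl⟩ := harc e (Finset.mem_Ico.2 ⟨by omega, he.2⟩)
      rw [h4 k hk]
      rcases Arc.getElem_list hk with ⟨h, -⟩ | ⟨-, -, h⟩
      · omega
      · exact h) (fun e he => by
      obtain ⟨k, hk, rfl⟩ := harc e he
      exact h5 k hk)
  have f1 : (solve.run σ).arr 1 = σ.arr 1 := arr_run_of_notMem (by decide) σ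
  have f2 : (solve.run σ).arr 2 = σ.arr 2 := arr_run_of_notMem (by decide) σ
  have f4 : (solve.run σ).arr 4 = σ.arr 4 := arr_run_of_notMem (by decide) σ
  generalize solve.run σ = υ at *
  rw [State.Kilter, f1, f2, f4] at hK
  -- The first `nD` positions are exactly those of the arcs `y d`, which are now open.
  have hcap' : ∀ (k : ℕ) (hk : k < L.length), υ.arr 3 k = L[k].cap' := by
    intro k hk
    rw [hcap, h3 k hk]
    rcases Arc.getElem_list hk with ⟨h, d, hd⟩ | ⟨h, hy, -⟩
    · rw [if_pos (by omega)]
      simp only [hLdef, hd]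
      rfl
    · rw [if_neg (by omega)]
      simp only [← hLdef] at hy
      generalize L[k] = a at hy
      cases a <;> first | rfl | exact absurd rfl (hy _)
  have hnet : ∀ (g : ℤ → ℤ) (v : Arc I → ℤ), (∀ (k : ℕ) (hk : k < L.length), g k = v L[k]) →
      ∀ x, divergence (Finset.Ico (0 : ℤ) L.length) (σ.arr 1) (σ.arr 2) g x = Arc.netflow v x := by
    intro g v hgv x
    refine sum_Ico_eq_sum_list L _ _ fun k hk => ?_
    rw [hgv k hk, h1 k hk, h2 k hk]
  have hrew : ∀ (g : ℤ → ℤ) (v : Arc I → ℤ), (∀ (k : ℕ) (hk : k < L.length), g k = v L[k]) →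
      ∑ e ∈ Finset.Ico (0 : ℤ) L.length, σ.arr 4 e * g e = ∑ d, v (.y d) * I.w d := by
    intro g v hgv
    rw [sum_Ico_eq_sum_list L _ (fun a => a.reward * v a) fun k hk => by rw [hgv k hk, h4 k hk],
      Arc.sum_list]
    simp [Arc.reward, mul_comm]
  set v : Arc I → ℤ := fun a => υ.arr 5 (L.idxOf a : ℕ) with hv
  have hv5 : ∀ (k : ℕ) (hk : k < L.length), υ.arr 5 k = v L[k] := by
    intro k hk
    rw [hv]
    simp only [(Arc.nodup_list I).idxOf_getElem k hk, hLdef]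
  have hget : ∀ a : Arc I, ∃ (k : ℕ) (hk : k < L.length), L[k] = a := fun a =>
    List.getElem_of_mem (Arc.mem_list a)
  have hcirc : IsCirculation v := by
    refine ⟨fun a => ?_, fun a => ?_, fun x => ?_⟩
    · obtain ⟨k, hk, rfl⟩ := hget a
      rw [← hv5 k hk]
      exact hK.nonneg k (Finset.mem_Ico.2 ⟨by omega, by omega⟩)
    · obtain ⟨k, hk, rfl⟩ := hget a
      rw [← hv5 k hk, ← hcap' k hk]
      exact hK.le_cap k (Finset.mem_Ico.2 ⟨by omega, by omega⟩)
    · have e0 : ∀ x ∈ Finset.Ico (0 : ℤ) (3 + I.nR * I.nS + 2 * I.nD), Arc.netflow v x = 0 :=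
        fun x hx => by rw [← hnet _ v hv5 x]; exact hdiv x hx
      have h3' := I.three_le
      refine Arc.netflow_eq_zero (e0 _ ?_) (fun r s => e0 _ ?_) (fun d => e0 _ ?_)
        (fun d => e0 _ ?_) x
      · exact Finset.mem_Ico.2 ⟨le_rfl, by omega⟩
      · have := I.supplyNode_lt r s; exact Finset.mem_Ico.2 ⟨by omega, by omega⟩
      · have := I.inNode_lt d; exact Finset.mem_Ico.2 ⟨by omega, by omega⟩
      · have := I.outNode_lt d; exact Finset.mem_Ico.2 ⟨by omega, by omega⟩
  refine ⟨v, ⟨hcirc.feasible hI, fun X' hX' => ?_⟩, hv5⟩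
  have hc' := isCirculation_ofSolution hX' hI
  set g : ℤ → ℤ := fun e => (L.map (ofSolution X')).getD e.toNat 0 with hg
  have hg' : ∀ (k : ℕ) (hk : k < L.length), g k = ofSolution X' L[k] := by
    intro k hk
    simp [hg, hk]
  -- The competitor is the circulation of an arbitrary feasible solution, listed in the order of the
  -- arcs.
  have := hK.reward_le ht hh hdiv (g := g) (fun x _ => by rw [hnet _ _ hg', hc'.netflow])
    (fun e he => by
      obtain ⟨k, hk, rfl⟩ := harc e he
      rw [hg' k hk]; exact hc'.nonneg _)
    (fun e he => by
      obtain ⟨k, hk, rfl⟩ := harc e he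
      rw [hg' k hk, hcap' k hk]; exact hc'.le_cap _)
  rw [hrew _ _ hg', hrew _ _ hv5] at this
  exact this

/-- The program. -/
def program : Stmt := block [load, count, copyInput, layout, build, solve, writeOutput]

/-- A polynomial in the number of demands, types and locations that bounds the numbers of rounds of
all loops. -/
noncomputable def roundsBound : Polynomial ℕ :=
  3 + 3 * Polynomial.X + 2 * Polynomial.X ^ 2 + 2 * Polynomial.X ^ 3

theorem roundsBound_eval (n : ℕ) : roundsBound.eval n = 3 + 3 * n + 2 * n ^ 2 + 2 * n ^ 3 := by
  have h2 : Polynomial.eval n (2 : Polynomial ℕ) = 2 := by simp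
  have h3 : Polynomial.eval n (3 : Polynomial ℕ) = 3 := by simp
  simp only [roundsBound, Polynomial.eval_add, Polynomial.eval_mul, Polynomial.eval_pow,
    Polynomial.eval_X, h2, h3]

/-- A bound for the number of steps of the program. -/
noncomputable def stepsBound : Polynomial ℕ :=
  (load.time + (count.time + (copyInput.time + (layout.time + (build.time +
    (solve.time + writeOutput.time)))))).comp roundsBound

theorem exec_stmt {s : Stmt} (h : s.ok = true) {N : ℕ} {σ : State}
    (hN : ∀ b ∈ s.bounds, (σ.reg b).toNat ≤ N) :
    ∃ t, Exec s.toProg σ t (s.run σ) ∧ t ≤ s.time.eval N := by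
  simp only [ok, Bool.and_eq_true, List.all_eq_true, Bool.not_eq_true', List.contains_eq_mem,
    decide_eq_false_iff_not] at h
  exact exec_toProg h.1 h.2 hN

theorem solvable_mR1D : SolvableInPolyTime Instance.IsmR1D := by
  refine ⟨program.toProg, stepsBound, fun I hI => ?_⟩
  have hsize : I.nD + I.nR + I.nS ≤ I.size := by simp only [Instance.size]; omega
  set N := roundsBound.eval I.size with hNdef
  have hN : 3 + 3 * (I.nD + I.nR + I.nS) + 2 * (I.nD + I.nR + I.nS) ^ 2 +
      2 * (I.nD + I.nR + I.nS) ^ 3 ≤ N := by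
    rw [hNdef, roundsBound_eval]
    gcongr
  have hcnt : I.cnt ≤ N := by
    have : (3 * (I.nD + I.nR + I.nS) + 3 + 2 * (I.nD + I.nR + I.nS) * (I.nD + I.nR + I.nS) : ℕ) ≤ N := by
      refine le_trans ?_ hN
      rw [pow_two, mul_assoc]
      omega
    rw [Instance.cnt]
    exact_mod_cast this
  -- Two families of arcs have three indices, two have two and two have one. This accounts for the
  -- cubic and quadratic terms of `roundsBound`.
  have hlist : (Arc.list I).length ≤ N := by
    refine le_trans ?_ hN
    rw [Arc.length_list]
    set a := I.nD
    set b := I.nR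
    set c := I.nS
    have e1 : b * (c * a) ≤ (a + b + c) ^ 3 := by
      calc b * (c * a) ≤ (a + b + c) * ((a + b + c) * (a + b + c)) := by gcongr <;> omega
        _ = _ := by ring
    have e2 : b * (a * a) ≤ (a + b + c) ^ 3 := by
      calc b * (a * a) ≤ (a + b + c) * ((a + b + c) * (a + b + c)) := by gcongr <;> omega
        _ = _ := by ring
    have e3 : b * a ≤ (a + b + c) ^ 2 := by
      calc b * a ≤ (a + b + c) * (a + b + c) := by gcongr <;> omega
        _ = _ := by ring
    have e4 : b * c ≤ (a + b + c) ^ 2 := by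
      calc b * c ≤ (a + b + c) * (a + b + c) := by gcongr <;> omega
        _ = _ := by ring
    omega
  have hnodes : (3 + I.nR * I.nS + 2 * I.nD : ℕ) ≤ N := by
    refine le_trans ?_ hN
    have e4 : I.nR * I.nS ≤ (I.nD + I.nR + I.nS) ^ 2 := by
      calc I.nR * I.nS ≤ (I.nD + I.nR + I.nS) * (I.nD + I.nR + I.nS) := by gcongr <;> omega
        _ = _ := by ring
    omega
  have hdim : I.nD + I.nR + I.nS ≤ N := by omega
  obtain ⟨l0, l1, l2, l3, l4⟩ := load_spec I
  have c4 := count_load_spec I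
  obtain ⟨hin, h16⟩ := readInput_spec I
  -- The time bound is applied stage by stage, because early stages write registers that bound the
  -- loops of later ones. At the start of each stage, the registers bounding its loops hold at most
  -- `N`.
  obtain ⟨t₁, x₁, b₁⟩ := exec_stmt (s := load) (N := N) (σ := State.init I.encode) rfl (by
    simp [load, block, bounds])
  obtain ⟨t₂, x₂, b₂⟩ := exec_stmt (s := count) (N := N) (σ := load.run (State.init I.encode)) rfl (by
    simp only [count, bounds, List.forall_mem_cons, List.not_mem_nil, false_implies, implies_true,
      and_true, l3]
    omega)
  have n : ∀ x, x ≠ 4 → x ≠ 10 → x ≠ 11 → (count.run (load.run (State.init I.encode))).reg x =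
      (load.run (State.init I.encode)).reg x := fun x h4 h10 h11 =>
    reg_run_of_notMem (by simp [count, writes, h4, h10, h11]) _
  have n0 := n 0 (by decide) (by decide) (by decide)
  have n1 := n 1 (by decide) (by decide) (by decide)
  have n2 := n 2 (by decide) (by decide) (by decide)
  have e : readInput.run (State.init I.encode) =
    layout.run (copyInput.run (count.run (load.run (State.init I.encode)))) := rfl
  rw [e] at hin h16
  generalize load.run (State.init I.encode) = s₁ at *
  generalize count.run s₁ = s₂ at *
  obtain ⟨t₃, x₃, b₃⟩ := exec_stmt (s := copyInput) (N := N) (σ := s₂) rfl (by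
    simp only [copyInput, bounds, List.forall_mem_cons, List.not_mem_nil, false_implies,
      implies_true, and_true, c4]
    omega)
  have o : ∀ x, x ≠ 10 → (copyInput.run s₂).reg x = s₂.reg x := fun x h10 =>
    reg_run_of_notMem (by simp [copyInput, writes, h10]) s₂
  have o0 := o 0 (by decide)
  have o1 := o 1 (by decide)
  have o2 := o 2 (by decide)
  generalize copyInput.run s₂ = s₃ at *
  obtain ⟨t₄, x₄, b₄⟩ := exec_stmt (s := layout) (N := N) (σ := s₃) rfl (by
    simp only [layout, rows, block, bounds, List.append_nil, List.nil_append, List.cons_append,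
      List.forall_mem_cons, List.not_mem_nil, false_implies, implies_true, and_true, o0, o1, o2,
      n0, n1, n2, l0, l1, l2]
    omega)
  generalize layout.run s₃ = s₄ at *
  have hL := build_spec hin h16
  obtain ⟨t₅, x₅, b₅⟩ := exec_stmt (s := build) (N := N) (σ := s₄) rfl (by
    have h : ∀ b ∈ build.bounds, b = 0 ∨ b = 1 ∨ b = 2 := by decide
    intro b hb
    rcases h b hb with rfl | rfl | rfl
    · rw [hin.nD]; omega
    · rw [hin.nR]; omega
    · rw [hin.nS]; omega)
  have hin5 := hin.run (s := build) rfl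
  generalize build.run s₄ = s₅ at *
  obtain ⟨t₆, x₆, b₆⟩ := exec_stmt (s := solve) (N := N) (σ := s₅) rfl (by
    have h : ∀ b ∈ solve.bounds, b = 0 ∨ b = 9 ∨ b = 16 := by decide
    intro b hb
    rcases h b hb with rfl | rfl | rfl
    · rw [hin5.nD]; omega
    · rw [hin5.nodes]; omega
    · rw [hL.length]; omega)
  obtain ⟨v, hv, hout⟩ := solve_optimal hI hin5 hL
  have g16 : (solve.run s₅).reg 16 = (Arc.list I).length := by
    rw [reg_run_of_notMem (by decide), hL.length]
  generalize solve.run s₅ = s₆ at *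
  obtain ⟨t₇, x₇, b₇⟩ := exec_stmt (s := writeOutput) (N := N) (σ := s₆) rfl (by
    simp only [writeOutput, bounds, List.forall_mem_cons, List.not_mem_nil, false_implies,
      implies_true, and_true, g16]
    omega)
  refine ⟨_, _, toSolution v, .seq x₁ (.seq x₂ (.seq x₃ (.seq x₄ (.seq x₅ (.seq x₆ x₇))))), ?_, hv,
    fun i hi => ?_⟩
  · simp only [stepsBound, Polynomial.eval_comp, Polynomial.eval_add, ← hNdef]
    omega
  · obtain ⟨R, hR⟩ := map_list v
    have hlen : (toSolution v).encode.length ≤ (Arc.list I).length := by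
      rw [← List.length_map v, hR, List.length_append]; omega
    have hi' : i < (Arc.list I).length := by omega
    rw [writeOutput_spec g16 (by omega) (by omega) (by omega), hout i hi']
    have : ((Arc.list I).map v)[i]'(by simpa using hi') = v (Arc.list I)[i] := by simp
    rw [← this]
    simp only [hR]
    rw [List.getElem_append_left]

theorem solvable_1R1D : SolvableInPolyTime Instance.Is1R1D := by
  obtain ⟨prog, bound, h⟩ := solvable_mR1D
  exact ⟨prog, bound, fun I hI => h I hI.2⟩

end ResourceAllocation

theorem mainTheorem9 :
    ResourceAllocation.SolvableInPolyTime ResourceAllocation.Instance.Is1R1D ∧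
      ResourceAllocation.SolvableInPolyTime ResourceAllocation.Instance.IsmR1D :=
  ⟨ResourceAllocation.solvable_1R1D, ResourceAllocation.solvable_mR1D⟩
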